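/- Let $n\ge 0$, let $X\subseteq\mathbb R^n$ be open, let $Y$ be an open subset of a real Banach space $H$, let $E,F$ be real Banach spaces, and let $1\le p\le\infty$, $0\le q\le\infty$. Let $C^p(X,E)$ be the space of all $C^p$ functions $X\to E$ with the topology generated by the seminorms $\rho_{K,k}(f)=\sup_{x\in K}\sup_{0\le j\le k}\|D^jf(x)\|$ ($K\subseteq X$ compact, $k\in\mathbb N\cup\{0\}$, $k\le p$), and similarly $C^q(Y,F)$. Let $T:C^p(X,E)\to C^q(Y,F)$ be a continuous linear operator that is separating (if for every $x\in X$ one has $f(x)=0$ or $g(x)=0$, then for every $y\in Y$ one has $Tf(y)=0$ or $Tg(y)=0$) and nowhere trivial (for every $y\in Y$ there is $f$ with $Tf(y)\ne0$). The support map of $T$ is defined as follows. Let $\mathbb R_\infty$ be the one-point compactification of $\mathbb R$, let $i:X\to\mathbb R_\infty^{C^p(X,\mathbb R)}$ be $i(x)=(\varphi(x))_\varphi$, and let $\mathcal AX$ be the closure of $i(X)$. For $y\in Y$ let $\mathcal O_y$ be the family of all open $U\subseteq\mathcal AX$ for which there is $f\in C^p(X,E)$ with $Tf(y)\neq0$ and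 $\overline{i(\{x : f(x)\ne 0\})}\subseteq U$. Then for every $y\in Y$ the intersection $\bigcap_{U\in\mathcal O_y}\overline U$ consists of exactly one point, which is of the form $i(h(y))$ with a unique $h(y)\in X$; the map $h=(h_1,\dots,h_n):Y\to X\subseteq\mathbb R^n$ is the support map of $T$. For $k\ge0$, $k\le p$, $y\in Y$ and a bounded symmetric $k$-linear map $S:(\mathbb R^n)^k\to E$ let $\Phi_k(y,S)=\frac1{k!}(Tf_{y,S})(y)$, where $f_{y,S}(x)=S\big((x-h(y))^k\big)$ (these are the coefficients in the representation $Tf(y)=\sum_k\Phi_k(y,D^kf(h(y)))$). For a multiindex $\lambda\in(\mathbb N\cup\{0\})^n$ and $u\in E$ let $S_{\lambda,u}$ be the symmetric $|\lambda|$-linear map with $S_{\lambda,u}x^{|\lambda|}=x^\lambda u$. For $1\le i\le n$ let $U_i$ be the set of all $y_0\in Y$ for which there are $m_0\ge0$ and an open neighborhood $V\subseteq Y$ of $y_0$ such that $\Phi_{|\lambda|}(y,S_{\lambda,u})=0$ for all $y\in V$, $u\in E$ and $\lambda$ with $|\lambda|\le p$ and $\lambda_i>m_0$, and such that $\Phi_{|\mu|}(y_0,S_{\mu,u})\ne0$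 for some $u\in E$ and some multiindex $\mu$ with $|\mu|\le p$ and $\mu_i=m_0$. Then for $1\le i\le n$ the set $U_i$ is open and dense in $Y$ and $h_i$ is $C^q$ on $U_i$. Hence $h$ is $C^q$ on the set $U=\bigcap_{i=1}^nU_i$, which is open and dense in $Y$ (for $n=0$, $U=Y$). -/

import Mathlib

open Set TopologicalSpace
open scoped Nat

noncomputable section

namespace SepMap

section Spaces

variable {G : Type*} [NormedAddCommGroup G] [NormedSpace ℝ G]
variable {E : Type*} [NormedAddCommGroup E] [NormedSpace ℝ E]

/-- Extension by zero to the whole space of a function on the set `X`. -/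
def zeroExt {X : Set G} (f : X → E) : G → E := Function.extend Subtype.val f 0

theorem zeroExt_apply {X : Set G} (f : X → E) (x : X) : zeroExt f x = f x :=
  Subtype.val_injective.extend_apply f 0 x

theorem zeroExt_add {X : Set G} (f g : X → E) : zeroExt (f + g) = zeroExt f + zeroExt g := by
  funext x
  by_cases hx : x ∈ X
  · simp only [Pi.add_apply]
    rw [zeroExt_apply _ ⟨x, hx⟩, zeroExt_apply f ⟨x, hx⟩, zeroExt_apply g ⟨x, hx⟩]; rfl
  · have hne : ¬ ∃ a : X, (a : G) = x := by rintro ⟨a, rfl⟩; exact hx a.2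
    simp [zeroExt, Function.extend_apply' _ _ _ hne]

theorem zeroExt_smul {X : Set G} (c : ℝ) (f : X → E) : zeroExt (c • f) = c • zeroExt f := by
  funext x
  by_cases hx : x ∈ X
  · simp only [Pi.smul_apply]
    rw [zeroExt_apply _ ⟨x, hx⟩, zeroExt_apply f ⟨x, hx⟩]; rfl
  · have hne : ¬ ∃ a : X, (a : G) = x := by rintro ⟨a, rfl⟩; exact hx a.2
    simp [zeroExt, Function.extend_apply' _ _ _ hne]

/-- The function `f`, defined on the set `X`, is of class `C^p` on the subset `W` of `X`
(only used for `W` open in the ambient space). -/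
def IsCkOn (p : ℕ∞) {X : Set G} (f : X → E) (W : Set X) : Prop :=
  ContDiffOn ℝ (p : WithTop ℕ∞) (zeroExt f) (Subtype.val '' W)

/-- The vector space of `C^p` functions `X → E`, as a subspace of all functions. -/
def ckSubmodule (p : ℕ∞) (X : Opens G) (E : Type*) [NormedAddCommGroup E] [NormedSpace ℝ E] :
    Submodule ℝ (X → E) where
  carrier := {f | ContDiffOn ℝ (p : WithTop ℕ∞) (zeroExt (X := (X : Set G)) f) X}
  add_mem' {f g} hf hg := by
    simp only [mem_ofPred_eq] at hf hg ⊢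
    rw [zeroExt_add]; exact hf.add hg
  zero_mem' := by
    have h0 : zeroExt (X := (X : Set G)) (0 : X → E) = 0 := by
      have := zeroExt_smul (X := (X : Set G)) 0 (0 : X → E)
      simpa using this
    simp only [mem_ofPred_eq]
    rw [h0]; exact contDiffOn_const
  smul_mem' c f hf := by
    simp only [mem_ofPred_eq] at hf ⊢
    rw [zeroExt_smul]; exact hf.const_smul c

/-- The space `C^p(X, E)`.  It is not reducible to a subtype, so that it does not carry the
topology of pointwise convergence. -/
def Ck (p : ℕ∞) (X : Opens G) (E : Type*) [NormedAddCommGroup E] [NormedSpace ℝ E] : Type _ :=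
  ckSubmodule p X E

instance (p : ℕ∞) (X : Opens G) : AddCommGroup (Ck p X E) :=
  inferInstanceAs (AddCommGroup (ckSubmodule p X E))

instance (p : ℕ∞) (X : Opens G) : Module ℝ (Ck p X E) :=
  inferInstanceAs (Module ℝ (ckSubmodule p X E))

instance (p : ℕ∞) (X : Opens G) : CoeFun (Ck p X E) (fun _ => X → E) := ⟨fun f => f.1⟩

variable {p : ℕ∞} {X : Opens G}

namespace Ck

/-- The `j`-th Fréchet derivative `D^j f` (used at points of `X` only). -/
def D (j : ℕ) (f : Ck p X E) (x : G) : ContinuousMultilinearMap ℝ (fun _ : Fin j => G) E :=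
  iteratedFDeriv ℝ j (zeroExt (X := (X : Set G)) f) x

theorem contDiffAt (f : Ck p X E) {x : G} (hx : x ∈ X) :
    ContDiffAt ℝ (p : WithTop ℕ∞) (zeroExt (X := (X : Set G)) f) x :=
  (f.2 : ContDiffOn ℝ _ _ _).contDiffAt (X.isOpen.mem_nhds hx)

theorem D_add {j : ℕ} (hj : (j : ℕ∞) ≤ p) (f g : Ck p X E) {x : G} (hx : x ∈ X) :
    D j (f + g) x = D j f x + D j g x := by
  have hj' : ((j : ℕ) : WithTop ℕ∞) ≤ (p : WithTop ℕ∞) := by exact_mod_cast hj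
  have : zeroExt (X := (X : Set G)) (f + g : Ck p X E) =
      zeroExt (X := (X : Set G)) f + zeroExt (X := (X : Set G)) g := zeroExt_add _ _
  unfold D
  rw [this]
  exact iteratedFDeriv_add_apply ((contDiffAt f hx).of_le hj') ((contDiffAt g hx).of_le hj')

theorem D_smul {j : ℕ} (hj : (j : ℕ∞) ≤ p) (c : ℝ) (f : Ck p X E) {x : G} (hx : x ∈ X) :
    D j (c • f) x = c • D j f x := by
  have hj' : ((j : ℕ) : WithTop ℕ∞) ≤ (p : WithTop ℕ∞) := by exact_mod_cast hj
  have : zeroExt (X := (X : Set G)) (c • f : Ck p X E) =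
      c • zeroExt (X := (X : Set G)) f := zeroExt_smul _ _
  unfold D
  rw [this]
  exact iteratedFDeriv_const_smul_apply ((contDiffAt f hx).of_le hj')

theorem continuousOn_D {j : ℕ} (hj : (j : ℕ∞) ≤ p) (f : Ck p X E) :
    ContinuousOn (D j f) X := by
  have hj' : ((j : ℕ) : WithTop ℕ∞) ≤ (p : WithTop ℕ∞) := by exact_mod_cast hj
  have h := (f.2 : ContDiffOn ℝ _ _ _).continuousOn_iteratedFDerivWithin hj'
    X.isOpen.uniqueDiffOn
  exact h.congr fun x hx => (iteratedFDerivWithin_of_isOpen j X.isOpen hx).symm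

end Ck

/-- Index set of the seminorms: compact subsets `K` of `X`, and natural numbers `k ≤ p`. -/
abbrev SeminormIndex (p : ℕ∞) (X : Opens G) : Type _ :=
  {K : Set G // IsCompact K ∧ K ⊆ X} × {k : ℕ // (k : ℕ∞) ≤ p}

instance : Nonempty (SeminormIndex p X) :=
  ⟨⟨∅, isCompact_empty, empty_subset _⟩, ⟨0, by simp⟩⟩

theorem bddAbove_D (i : SeminormIndex p X) (f : Ck p X E) :
    BddAbove (range fun a : i.1.1 × Fin (i.2.1 + 1) => ‖Ck.D a.2 f a.1‖) := by
  obtain ⟨⟨K, hK, hKX⟩, ⟨k, hk⟩⟩ := i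
  have hle : ∀ j : Fin (k + 1), ((j : ℕ) : ℕ∞) ≤ p := fun j =>
    le_trans (by exact_mod_cast Nat.lt_succ_iff.mp j.2) hk
  have h : ∀ j : Fin (k + 1), ∃ C, ∀ x ∈ K, ‖Ck.D j f x‖ ≤ C := fun j =>
    hK.exists_bound_of_continuousOn ((Ck.continuousOn_D (hle j) f).mono hKX)
  choose C hC using h
  refine ⟨∑ j, |C j|, ?_⟩
  rintro _ ⟨⟨x, j⟩, rfl⟩
  calc ‖Ck.D j f x‖ ≤ C j := hC j x x.2
    _ ≤ |C j| := le_abs_self _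
    _ ≤ ∑ j, |C j| := Finset.single_le_sum (f := fun j => |C j|)
        (fun _ _ => abs_nonneg _) (Finset.mem_univ j)

/-- The seminorms `ρ_{K,k}(f) = sup_{x ∈ K} sup_{0 ≤ j ≤ k} ‖D^j f(x)‖` on `C^p(X, E)`. -/
def rho (p : ℕ∞) (X : Opens G) (E : Type*) [NormedAddCommGroup E] [NormedSpace ℝ E] :
    SeminormFamily ℝ (Ck p X E) (SeminormIndex p X) := fun i =>
  Seminorm.of (fun f => ⨆ a : i.1.1 × Fin (i.2.1 + 1), ‖Ck.D a.2 f a.1‖)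
    (fun f g => by
      have hle : ∀ j : Fin (i.2.1 + 1), ((j : ℕ) : ℕ∞) ≤ p := fun j =>
        le_trans (by exact_mod_cast Nat.lt_succ_iff.mp j.2) i.2.2
      rcases isEmpty_or_nonempty (i.1.1 × Fin (i.2.1 + 1)) with he | he
      · simp [Real.iSup_of_isEmpty]
      · refine ciSup_le fun a => ?_
        rw [Ck.D_add (hle a.2) f g (i.1.2.2 a.1.2)]
        exact (norm_add_le _ _).trans
          (add_le_add (le_ciSup (bddAbove_D i f) a) (le_ciSup (bddAbove_D i g) a)))
    (fun c f => by
      have hle : ∀ j : Fin (i.2.1 + 1), ((j : ℕ) : ℕ∞) ≤ p := fun j =>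
        le_trans (by exact_mod_cast Nat.lt_succ_iff.mp j.2) i.2.2
      rw [Real.mul_iSup_of_nonneg (norm_nonneg c)]
      congr 1
      funext a
      rw [Ck.D_smul (hle a.2) c f (i.1.2.2 a.1.2), norm_smul])

/-- The topology of `C^p(X, E)` is the one generated by the seminorms `ρ_{K,k}`. -/
instance : TopologicalSpace (Ck p X E) := (rho p X E).moduleFilterBasis.topology

theorem withSeminorms_rho : WithSeminorms (rho p X E) := ⟨rfl⟩

/-! ### The compactification of `X` determined by `C^p(X)` -/

/-- The evaluation map `x ↦ (f(x))_f` into the power of the one-point compactification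
of `ℝ` over the index set `C^p(X)`. -/
def evalMap (p : ℕ∞) (X : Opens G) (x : X) : Ck p X ℝ → OnePoint ℝ :=
  fun f => ((f x : ℝ) : OnePoint ℝ)

/-- The `C^p(X)`-compactification of `X`: the closure of the image of `evalMap`. -/
abbrev Compactif (p : ℕ∞) (X : Opens G) : Type _ :=
  ↥(closure (range (evalMap p X)))

/-- The canonical embedding `i` of `X` into its compactification. -/
def emb (p : ℕ∞) (X : Opens G) (x : X) : Compactif p X :=
  ⟨evalMap p X x, subset_closure (mem_range_self x)⟩

/-- The closure in the compactification of the image of `{x | f x ≠ 0}`. -/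
def suppClosure (f : Ck p X E) : Set (Compactif p X) :=
  closure (emb p X '' {x | f x ≠ 0})

end Spaces

section Operators

variable {G : Type*} [NormedAddCommGroup G] [NormedSpace ℝ G]
variable {H : Type*} [NormedAddCommGroup H] [NormedSpace ℝ H]
variable {E : Type*} [NormedAddCommGroup E] [NormedSpace ℝ E]
variable {F : Type*} [NormedAddCommGroup F] [NormedSpace ℝ F]
variable {p q : ℕ∞} {X : Opens G} {Y : Opens H}

/-- Two functions are disjoint if at each point at least one of them vanishes. -/
def DisjointFun {A B : Type*} [Zero B] (f g : A → B) : Prop := ∀ x, f x = 0 ∨ g x = 0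

/-- Separating (disjointness preserving) operators. -/
def IsSeparating (T : Ck p X E →L[ℝ] Ck q Y F) : Prop :=
  ∀ f g : Ck p X E, DisjointFun f g → DisjointFun (T f) (T g)

/-- `T` is nowhere trivial: at each `y ∈ Y` some `T f` does not vanish. -/
def IsNowhereTrivial (T : Ck p X E →L[ℝ] Ck q Y F) : Prop :=
  ∀ y : Y, ∃ f : Ck p X E, T f y ≠ 0

/-- The family `𝒪_y` of all open sets `U` of the compactification that contain the closed
support of some `f` with `T f (y) ≠ 0`. -/
def openFamily (T : Ck p X E →L[ℝ] Ck q Y F) (y : Y) : Set (Set (Compactif p X)) :=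
  {U | IsOpen U ∧ ∃ f : Ck p X E, T f y ≠ 0 ∧ suppClosure f ⊆ U}

/-- `h` is the support map of `T` (with `X` identified with its image in the compactification):
`h y` is the only point of the intersection of the closures of the members of `𝒪_y`. -/
def IsSupportMap (T : Ck p X E →L[ℝ] Ck q Y F) (h : Y → X) : Prop :=
  ∀ y : Y, ⋂ U ∈ openFamily T y, closure U = {emb p X (h y)}

/-- Bounded symmetric `k`-linear maps from `G^k` to `E`. -/
abbrev SymForm (k : ℕ) (G E : Type*) [NormedAddCommGroup G] [NormedSpace ℝ G]
    [NormedAddCommGroup E] [NormedSpace ℝ E] : Type _ :=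
  {S : ContinuousMultilinearMap ℝ (fun _ : Fin k => G) E //
    ∀ (σ : Equiv.Perm (Fin k)) (v : Fin k → G), S (v ∘ σ) = S v}

/-- The function `x ↦ S((x - a)^k)` on `X`. -/
def powFun (p : ℕ∞) (X : Opens G) {k : ℕ} (S : SymForm k G E) (a : G) : Ck p X E :=
  ⟨fun x => S.1 (fun _ => (x : G) - a), by
    have hS : ContDiff ℝ (p : WithTop ℕ∞) (fun x : G => S.1 (fun _ => x - a)) :=
      S.1.contDiff.comp (contDiff_pi.2 fun _ => contDiff_id.sub contDiff_const)
    exact hS.contDiffOn.congr fun x hx => zeroExt_apply (X := (X : Set G)) _ ⟨x, hx⟩⟩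

/-- The coefficients of the representation `T f (y) = ∑ₖ Φₖ(y, D^k f(h(y)))`:
`Φₖ(y, S) = (T f)(y) / k!`, where `f(x) = S((x - h(y))^k)`. -/
def Phi (T : Ck p X E →L[ℝ] Ck q Y F) (h : Y → X) (k : ℕ) (y : Y) (S : SymForm k G E) : F :=
  ((k ! : ℝ)⁻¹) • T (powFun p X S (h y)) y

end Operators

section Euclidean

variable {n : ℕ} {E : Type*} [NormedAddCommGroup E] [NormedSpace ℝ E]

/-- The order of a multiindex. -/
abbrev order (l : Fin n → ℕ) : ℕ := ∑ i, l i

/-- The list of coordinates in which each `i` occurs `l i` times. -/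
def coordList (l : Fin n → ℕ) (j : Fin (order l)) : Fin n := (finSigmaFinEquiv.symm j).1

/-- The multilinear map `(v_1, …, v_k) ↦ (∏ⱼ (v_j)_{c(j)}) u`, `c` the list of coordinates. -/
def monoForm (l : Fin n → ℕ) (u : E) :
    ContinuousMultilinearMap ℝ (fun _ : Fin (order l) => EuclideanSpace ℝ (Fin n)) E :=
  ((ContinuousMultilinearMap.mkPiAlgebra ℝ (Fin (order l)) ℝ).compContinuousLinearMap
    (fun j => EuclideanSpace.proj (coordList l j))).smulRight u

theorem monoForm_apply (l : Fin n → ℕ) (u : E)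
    (v : Fin (order l) → EuclideanSpace ℝ (Fin n)) :
    monoForm l u v = (∏ j, v j (coordList l j)) • u := by
  simp [monoForm]

/-- The symmetric `k`-linear map `S_{l,u}`, `k = |l|`, with `S_{l,u} x^k = x^l u`:
the symmetrization of `monoForm l u`. -/
def symMono (l : Fin n → ℕ) (u : E) : SymForm (order l) (EuclideanSpace ℝ (Fin n)) E :=
  ⟨((order l)! : ℝ)⁻¹ • ∑ σ : Equiv.Perm (Fin (order l)), (monoForm l u).domDomCongr σ, by
    intro τ v
    simp only [smul_apply, sum_apply,
      ContinuousMultilinearMap.domDomCongr_apply, Function.comp_apply]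
    congr 1
    exact Fintype.sum_equiv (Equiv.mulLeft τ) _ _ fun σ => rfl⟩

/-- The defining property of `S_{l,u}`. -/
theorem symMono_diag (l : Fin n → ℕ) (u : E) (x : EuclideanSpace ℝ (Fin n)) :
    (symMono l u).1 (fun _ => x) = (∏ i, x i ^ l i) • u := by
  have hprod : ∏ j : Fin (order l), x (coordList l j) = ∏ i, x i ^ l i := by
    unfold coordList
    rw [Equiv.prod_comp finSigmaFinEquiv.symm (fun s : (i : Fin n) × Fin (l i) => x s.1),
      Fintype.prod_sigma]
    simp
  have hk : (((order l)! : ℕ) : ℝ) ≠ 0 := by exact_mod_cast Nat.factorial_ne_zero _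
  simp only [symMono, smul_apply, sum_apply,
    ContinuousMultilinearMap.domDomCongr_apply, monoForm_apply, hprod, Finset.sum_const,
    Finset.card_univ, Fintype.card_perm, Fintype.card_fin]
  rw [← Nat.cast_smul_eq_nsmul ℝ, inv_smul_smul₀ hk]

variable {H : Type*} [NormedAddCommGroup H] [NormedSpace ℝ H]
variable {F : Type*} [NormedAddCommGroup F] [NormedSpace ℝ F]
variable {p q : ℕ∞} {X : Opens (EuclideanSpace ℝ (Fin n))} {Y : Opens H}

/-- The set `U_i` of all `y₀ ∈ Y` for which there are `m₀ ≥ 0` and an open neighbourhood `V` of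
`y₀` so that `Φ_{|l|}(y, S_{l,u}) = 0` if `y ∈ V`, `u ∈ E` and `l_i > m₀`, and
`Φ_{|m|}(y₀, S_{m,u}) ≠ 0` for some `u ∈ E` and some multiindex `m` with `m_i = m₀`.
(Only multiindices of order at most `p` occur, since `Φₖ` is considered for `k ≤ p` only.) -/
def goodSet (T : Ck p X E →L[ℝ] Ck q Y F) (h : Y → X) (i : Fin n) : Set Y :=
  {y₀ | ∃ m₀ : ℕ, ∃ V : Set Y, IsOpen V ∧ y₀ ∈ V ∧
    (∀ y ∈ V, ∀ u : E, ∀ l : Fin n → ℕ, (order l : ℕ∞) ≤ p → m₀ < l i →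
      Phi T h (order l) y (symMono l u) = 0) ∧
    ∃ (m : Fin n → ℕ) (u : E), (order m : ℕ∞) ≤ p ∧ m i = m₀ ∧
      Phi T h (order m) y₀ (symMono m u) ≠ 0}

end Euclidean

end SepMap

end

/-!
Each functional `f ↦ T f y` is dominated by one seminorm, so by a compactness argument its support
contains a point `h y`, and separation makes the functional local there. Locality together with
continuity bounds its order, hence it is determined by its values on the monomials centred at
`h y`; moreover the order is locally bounded in `y`. On a dense open set, the least `m` such that
`T ((xᵢ - hᵢ(y)) ^ m f) y = 0` for all `f` is therefore locally constant. Since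
`d/ds (xᵢ - s) ^ m = -m (xᵢ - s) ^ (m - 1)`, minimality of `m` makes `s = hᵢ(y)` a simple root of
`ψ (T ((xᵢ - s) ^ m f) y)` for suitable `f` and `ψ`, a polynomial in `s` with `C^q` coefficients,
and the implicit function theorem applies in finite dimensions.
-/

noncomputable section

namespace SepMap

open Filter Topology

section Calculus

variable {G : Type*} [NormedAddCommGroup G] [NormedSpace ℝ G]
variable {E : Type*} [NormedAddCommGroup E] [NormedSpace ℝ E]

theorem iteratedFDeriv_add_two_apply {k : ℕ} {f : G → E} {x : G}
    (hf : ContDiffAt ℝ (k + 2 : ℕ) f x) (v : Fin (k + 2) → G) :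
    iteratedFDeriv ℝ (k + 2) f x v =
      fderiv ℝ (fderiv ℝ fun z => iteratedFDeriv ℝ k f z (Fin.tail (Fin.tail v))) x
        (v 0) (v 1) := by
  set g : G → E := fun z => iteratedFDeriv ℝ k f z (Fin.tail (Fin.tail v))
  have hg : ContDiffAt ℝ 2 g x :=
    (ContinuousMultilinearMap.apply ℝ _ E (Fin.tail (Fin.tail v))).contDiff.contDiffAt.comp x
      (hf.iteratedFDeriv_right (i := k) (by norm_cast; omega))
  have hg' : DifferentiableAt ℝ (fderiv ℝ g) x :=
    (hg.fderiv_right (m := 1) (by norm_num)).differentiableAt (by norm_num)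
  have hfirst : (fun z => iteratedFDeriv ℝ (k + 1) f z (Fin.tail v)) =ᶠ[𝓝 x]
      fun z => fderiv ℝ g z (v 1) := by
    have hlower : ContDiffAt ℝ (k + 1 : ℕ) f x := hf.of_le (by norm_cast; omega)
    filter_upwards [hlower.eventually (by simp)] with z hz
    exact (hz.differentiableAt_iteratedFDeriv (by norm_cast; omega)).iteratedFDeriv_succ_apply_left'
  rw [(hf.differentiableAt_iteratedFDeriv (by norm_cast; omega)).iteratedFDeriv_succ_apply_left',
    hfirst.fderiv_eq, fderiv_clm_apply hg' (differentiableAt_const _)]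
  simp

theorem iteratedFDeriv_comp_swap_zero_one {k : ℕ} {f : G → E} {x : G}
    (hf : ContDiffAt ℝ (k + 2 : ℕ) f x) (v : Fin (k + 2) → G) :
    iteratedFDeriv ℝ (k + 2) f x (v ∘ Equiv.swap 0 1) = iteratedFDeriv ℝ (k + 2) f x v := by
  have htail : Fin.tail (Fin.tail (v ∘ Equiv.swap 0 1)) = Fin.tail (Fin.tail v) := by
    funext j
    refine congrArg v (Equiv.swap_apply_of_ne_of_ne ?_ ?_) <;> simp [Fin.ext_iff]
  have hsymm : IsSymmSndFDerivAt ℝ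
      (fun z => iteratedFDeriv ℝ k f z (Fin.tail (Fin.tail v))) x :=
    ((ContinuousMultilinearMap.apply ℝ _ E (Fin.tail (Fin.tail v))).contDiff.contDiffAt.comp x
      (hf.iteratedFDeriv_right (m := 2) (i := k) (by norm_cast; omega))).isSymmSndFDerivAt
        (by simp)
  rw [iteratedFDeriv_add_two_apply hf, iteratedFDeriv_add_two_apply hf, htail, hsymm.eq]
  simp

theorem iteratedFDeriv_succ_comp_swap_succ {k : ℕ} {f : G → E} {x : G}
    (hf : ContDiffAt ℝ (k + 1 : ℕ) f x) {i j : Fin k}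
    (hsymm : ∀ᶠ z in 𝓝 x, ∀ w : Fin k → G,
      iteratedFDeriv ℝ k f z (w ∘ Equiv.swap i j) = iteratedFDeriv ℝ k f z w)
    (v : Fin (k + 1) → G) :
    iteratedFDeriv ℝ (k + 1) f x (v ∘ Equiv.swap i.succ j.succ) =
      iteratedFDeriv ℝ (k + 1) f x v := by
  have hd : DifferentiableAt ℝ (iteratedFDeriv ℝ k f) x :=
    hf.differentiableAt_iteratedFDeriv (by norm_cast; omega)
  have hhead : (v ∘ Equiv.swap i.succ j.succ) 0 = v 0 :=
    congrArg v (Equiv.swap_apply_of_ne_of_ne (Fin.succ_ne_zero i).symm (Fin.succ_ne_zero j).symm)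
  have htail : Fin.tail (v ∘ Equiv.swap i.succ j.succ) = Fin.tail v ∘ Equiv.swap i j := by
    funext l
    exact congrArg v ((Fin.succ_injective k).swap_apply i j l)
  rw [hd.iteratedFDeriv_succ_apply_left', hd.iteratedFDeriv_succ_apply_left', hhead, htail]
  exact congrArg (fun A : G →L[ℝ] E => A (v 0))
    (EventuallyEq.fderiv_eq (hsymm.mono fun z hz => hz (Fin.tail v)))

theorem iteratedFDeriv_comp_perm_of_contDiffAt {k : ℕ} {f : G → E} {x : G}
    (hf : ContDiffAt ℝ k f x) (σ : Equiv.Perm (Fin k)) (v : Fin k → G) :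
    iteratedFDeriv ℝ k f x (v ∘ σ) = iteratedFDeriv ℝ k f x v := by
  induction k generalizing x with
  | zero => exact congrArg _ (Subsingleton.elim _ _)
  | succ k ih =>
    have hσ : σ ∈ Submonoid.closure (range fun i : Fin k ↦ Equiv.swap i.castSucc i.succ) := by
      rw [Equiv.Perm.mclosure_swap_castSucc_succ]
      trivial
    induction hσ using Submonoid.closure_induction generalizing v with
    | one => rfl
    | mul a b _ _ ha hb => rw [Equiv.Perm.coe_mul, ← Function.comp_assoc, hb, ha]
    | mem s hs =>
      obtain ⟨i, rfl⟩ := hs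
      cases k with
      | zero => exact i.elim0
      | succ k =>
        cases i using Fin.cases with
        | zero => exact iteratedFDeriv_comp_swap_zero_one hf v
        | succ i =>
          refine iteratedFDeriv_succ_comp_swap_succ (i := i.castSucc) (j := i.succ) hf ?_ v
          have hlower : ContDiffAt ℝ (k + 1 : ℕ) f x := hf.of_le (by norm_cast; omega)
          filter_upwards [hlower.eventually (by simp)] with z hz w
          exact ih hz _ w

theorem norm_iteratedFDeriv_smul_le_of_contDiffAt {χ : G → ℝ} {f : G → E} {x : G} {j : ℕ}
    (hχ : ContDiffAt ℝ j χ x) (hf : ContDiffAt ℝ j f x) :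
    ‖iteratedFDeriv ℝ j (fun z => χ z • f z) x‖ ≤ ∑ i ∈ Finset.range (j + 1),
      (j.choose i : ℝ) * ‖iteratedFDeriv ℝ i χ x‖ * ‖iteratedFDeriv ℝ (j - i) f x‖ := by
  obtain ⟨U, hUχf, hU, hxU⟩ := eventually_nhds_iff.mp
    ((hχ.eventually (by simp)).and (hf.eventually (by simp)))
  simpa only [iteratedFDerivWithin_of_isOpen _ hU hxU] using norm_iteratedFDerivWithin_smul_le
    (fun z hz => (hUχf z hz).1.contDiffWithinAt) (fun z hz => (hUχf z hz).2.contDiffWithinAt)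
    hU.uniqueDiffOn hxU le_rfl

/-- All derivatives of `f` of order less than `k` vanish at `a`. -/
def VanishesTo (k : ℕ) (f : G → E) (a : G) : Prop :=
  ∀ j < k, iteratedFDeriv ℝ j f a = 0

namespace VanishesTo

variable {k l : ℕ} {f g : G → E} {χ : G → ℝ} {a : G}

theorem zero (f : G → E) (a : G) : VanishesTo 0 f a :=
  fun j hj => absurd hj j.not_lt_zero

theorem mono (hf : VanishesTo k f a) (h : l ≤ k) : VanishesTo l f a :=
  fun j hj => hf j (hj.trans_le h)

theorem congr (hf : VanishesTo k f a) (h : f =ᶠ[𝓝 a] g) : VanishesTo k g a := fun j hj => by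
  rw [← (h.iteratedFDeriv ℝ j).eq_of_nhds, hf j hj]

theorem smul {N : ℕ} (h₁ : VanishesTo k χ a) (h₂ : VanishesTo l f a)
    (hχ : ContDiffAt ℝ N χ a) (hf : ContDiffAt ℝ N f a) (hN : k + l ≤ N + 1) :
    VanishesTo (k + l) (fun x => χ x • f x) a := by
  intro j hj
  have hjN : (j : WithTop ℕ∞) ≤ N := by exact_mod_cast (by omega : j ≤ N)
  rw [← norm_le_zero_iff]
  refine (norm_iteratedFDeriv_smul_le_of_contDiffAt (hχ.of_le hjN) (hf.of_le hjN)).trans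
    (Finset.sum_nonpos fun i hi => ?_)
  rcases (by grind : i < k ∨ j - i < l) with h | h
  · simp [h₁ i h]
  · simp [h₂ _ h]

theorem pow (h : VanishesTo 1 χ a) (hχ : ContDiff ℝ (⊤ : ℕ∞) χ) (m : ℕ) :
    VanishesTo m (χ ^ m) a := by
  induction m with
  | zero => exact .zero _ _
  | succ m ih =>
    rw [pow_succ]
    exact ih.smul h ((hχ.pow m).of_le (by exact_mod_cast le_top)).contDiffAt
      (hχ.of_le (by exact_mod_cast le_top)).contDiffAt (Nat.le_succ _)

theorem prod {ι : Type*} {ψ : ι → G → ℝ} {m : ι → ℕ} (hψ : ∀ i, ContDiff ℝ (⊤ : ℕ∞) (ψ i))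
    (h : ∀ i, VanishesTo (m i) (ψ i) a) (S : Finset ι) :
    VanishesTo (∑ i ∈ S, m i) (∏ i ∈ S, ψ i) a := by
  classical
  induction S using Finset.induction_on with
  | empty => exact .zero _ _
  | insert i S hi ih =>
    rw [Finset.sum_insert hi, Finset.prod_insert hi]
    refine (h i).smul ih ((hψ i).of_le (by exact_mod_cast le_top)).contDiffAt ?_ (Nat.le_succ _)
    exact ((contDiff_prod' fun i _ => hψ i).of_le (by exact_mod_cast le_top)).contDiffAt

theorem norm_iteratedFDeriv_le {N : ℕ} {r η : ℝ} (h : VanishesTo N f a)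
    (hf : ∀ x ∈ Metric.ball a r, ContDiffAt ℝ N f x)
    (hη : ∀ x ∈ Metric.ball a r, ‖iteratedFDeriv ℝ N f x‖ ≤ η) {i j : ℕ} (hij : j + i = N)
    {x : G} (hx : x ∈ Metric.ball a r) : ‖iteratedFDeriv ℝ j f x‖ ≤ η * ‖x - a‖ ^ i := by
  induction i generalizing j x with
  | zero => subst hij; simpa using hη x hx
  | succ i ih =>
    have hη₀ : 0 ≤ η := (norm_nonneg _).trans (hη x hx)
    have hsub : Metric.closedBall a ‖x - a‖ ⊆ Metric.ball a r :=
      Metric.closedBall_subset_ball (by simpa [dist_eq_norm] using hx)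
    have hmean : ‖iteratedFDeriv ℝ j f x - iteratedFDeriv ℝ j f a‖ ≤
        η * ‖x - a‖ ^ i * ‖x - a‖ := by
      refine (convex_closedBall a ‖x - a‖).norm_image_sub_le_of_norm_fderiv_le (𝕜 := ℝ)
        (fun z hz => (hf z (hsub hz)).differentiableAt_iteratedFDeriv (by norm_cast; omega))
        (fun z hz => ?_) (by simp) (by simp [dist_eq_norm])
      have hza : ‖z - a‖ ≤ ‖x - a‖ := by simpa [dist_eq_norm] using hz
      rw [norm_fderiv_iteratedFDeriv]
      exact (ih (by omega) (hsub hz)).trans (by gcongr)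
    rwa [h j (by omega), sub_zero, mul_assoc, ← pow_succ] at hmean

theorem exists_norm_iteratedFDeriv_le {N : ℕ} (h : VanishesTo (N + 1) f a)
    (hf : ContDiffAt ℝ N f a) {η : ℝ} (hη : 0 < η) :
    ∃ r > 0, ∀ x ∈ Metric.ball a r, ContDiffAt ℝ N f x ∧
      ∀ j ≤ N, ‖iteratedFDeriv ℝ j f x‖ ≤ η * ‖x - a‖ ^ (N - j) := by
  have hcont : ContinuousAt (fun z => ‖iteratedFDeriv ℝ N f z‖) a :=
    (hf.iteratedFDeriv_right (m := 0) (i := N) (by simp)).continuousAt.norm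
  have hsmall : ∀ᶠ z in 𝓝 a, ‖iteratedFDeriv ℝ N f z‖ < η :=
    hcont.eventually_lt_const (by simpa [h N N.lt_succ_self] using hη)
  obtain ⟨r, hr, hball⟩ := Metric.eventually_nhds_iff_ball.mp
    ((hf.eventually (by simp)).and hsmall)
  exact ⟨r, hr, fun x hx => ⟨(hball x hx).1, fun j hj =>
    (h.mono N.le_succ).norm_iteratedFDeriv_le (fun z hz => (hball z hz).1)
      (fun z hz => (hball z hz).2.le) (by omega) hx⟩⟩

end VanishesTo

theorem vanishesTo_one_iff {f : G → E} {a : G} : VanishesTo 1 f a ↔ f a = 0 := by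
  simp only [VanishesTo, Nat.lt_one_iff, forall_eq]
  rw [← norm_eq_zero, norm_iteratedFDeriv_zero, norm_eq_zero]

theorem exists_norm_iteratedFDeriv_le_of_hasCompactSupport {f : G → E}
    (hf : ContDiff ℝ (⊤ : ℕ∞) f) (hsupp : HasCompactSupport f) (N : ℕ) :
    ∃ B, ∀ j ≤ N, ∀ x, ‖iteratedFDeriv ℝ j f x‖ ≤ B := by
  have hbound (j : ℕ) : ∃ B, ∀ x, ‖iteratedFDeriv ℝ j f x‖ ≤ B :=
    (hsupp.iteratedFDeriv (𝕜 := ℝ) j).exists_bound_of_continuous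
      (hf.continuous_iteratedFDeriv (by exact_mod_cast le_top))
  choose B hB using hbound
  obtain ⟨M, hM⟩ := ((Finset.range (N + 1)).image B).exists_le
  exact ⟨M, fun j hj x => (hB j x).trans
    (hM _ (Finset.mem_image_of_mem B (Finset.mem_range_succ_iff.mpr hj)))⟩

theorem norm_iteratedFDeriv_comp_smul_sub_le {f : G → E} (hf : ContDiff ℝ (⊤ : ℕ∞) f)
    (c : ℝ) (a x : G) (j : ℕ) {B : ℝ} (hB : ∀ z, ‖iteratedFDeriv ℝ j f z‖ ≤ B) :
    ‖iteratedFDeriv ℝ j (fun z => f (c • (z - a))) x‖ ≤ |c| ^ j * B := by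
  set L : G →L[ℝ] G := c • ContinuousLinearMap.id ℝ G
  have hL : ‖L‖ ≤ |c| := by
    rw [norm_smul]
    exact mul_le_of_le_one_right (abs_nonneg c) ContinuousLinearMap.norm_id_le
  change ‖iteratedFDeriv ℝ j (fun z => (f ∘ L) (z - a)) x‖ ≤ _
  rw [iteratedFDeriv_comp_sub, L.iteratedFDeriv_comp_right hf _ (by exact_mod_cast le_top)]
  calc _ ≤ ‖iteratedFDeriv ℝ j f (L (x - a))‖ * ∏ _i : Fin j, ‖L‖ :=
        ContinuousMultilinearMap.norm_compContinuousLinearMap_le _ _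
    _ ≤ B * |c| ^ j := by
        rw [Finset.prod_const, Finset.card_univ, Fintype.card_fin]
        gcongr
        exacts [(norm_nonneg _).trans (hB x), hB _]
    _ = |c| ^ j * B := mul_comm _ _

/-- The scaling of the two factors is that of a cut-off function of width `ε` and of a function
vanishing to order `N`. -/
theorem norm_iteratedFDeriv_smul_le_of_scale {χ : G → ℝ} {f : G → E} {x : G} {N : ℕ}
    {ε B η : ℝ} (hε : 0 < ε) (hε₁ : ε ≤ 1) (hχ : ContDiffAt ℝ N χ x) (hf : ContDiffAt ℝ N f x)
    (hB : ∀ j ≤ N, ‖iteratedFDeriv ℝ j χ x‖ ≤ ε⁻¹ ^ j * B)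
    (hη : ∀ j ≤ N, ‖iteratedFDeriv ℝ j f x‖ ≤ η * ε ^ (N - j)) {j : ℕ} (hj : j ≤ N) :
    ‖iteratedFDeriv ℝ j (fun z => χ z • f z) x‖ ≤ 2 ^ N * (B * η) := by
  have hB₀ : 0 ≤ B := by simpa using (norm_nonneg _).trans (hB 0 N.zero_le)
  have hη₀ : 0 ≤ η := by simpa using (norm_nonneg _).trans (hη N le_rfl)
  have hle : (j : WithTop ℕ∞) ≤ N := by exact_mod_cast hj
  calc _ ≤ ∑ i ∈ Finset.range (j + 1),
        (j.choose i : ℝ) * ‖iteratedFDeriv ℝ i χ x‖ * ‖iteratedFDeriv ℝ (j - i) f x‖ :=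
        norm_iteratedFDeriv_smul_le_of_contDiffAt (hχ.of_le hle) (hf.of_le hle)
    _ ≤ ∑ i ∈ Finset.range (j + 1), (j.choose i : ℝ) * (B * η) := by
        refine Finset.sum_le_sum fun i hi => ?_
        have hij : i ≤ j := Finset.mem_range_succ_iff.mp hi
        rw [mul_assoc]
        gcongr ?_ * ?_
        calc _ ≤ (ε⁻¹ ^ i * B) * (η * ε ^ (N - (j - i))) := by
              gcongr
              exacts [hB i (hij.trans hj), hη _ (by omega)]
          _ ≤ (ε⁻¹ ^ i * B) * (η * ε ^ i) := by
              gcongr _ * (_ * ?_)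
              exact pow_le_pow_of_le_one hε.le hε₁ (by omega)
          _ = (ε⁻¹ * ε) ^ i * (B * η) := by rw [mul_pow]; ring
          _ = B * η := by rw [inv_mul_cancel₀ hε.ne', one_pow, one_mul]
    _ = 2 ^ j * (B * η) := by
        rw [← Finset.sum_mul, ← Nat.cast_sum, Nat.sum_range_choose, Nat.cast_pow, Nat.cast_ofNat]
    _ ≤ 2 ^ N * (B * η) := by gcongr; norm_num

theorem exists_contDiff_cutoff_scale [FiniteDimensional ℝ G] (a : G) (N : ℕ) :
    ∃ B : ℝ, 0 ≤ B ∧ ∀ ε > 0, ∃ χ : G → ℝ, ContDiff ℝ (⊤ : ℕ∞) χ ∧ (∀ᶠ x in 𝓝 a, χ x = 1) ∧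
      (∀ x, ε ≤ ‖x - a‖ → χ =ᶠ[𝓝 x] 0) ∧ ∀ j ≤ N, ∀ x, ‖iteratedFDeriv ℝ j χ x‖ ≤ ε⁻¹ ^ j * B := by
  let b : ContDiffBump (0 : G) := ⟨1 / 4, 1 / 2, by norm_num, by norm_num⟩
  have hb : ContDiff ℝ (⊤ : ℕ∞) b := b.contDiff
  obtain ⟨B, hB⟩ := exists_norm_iteratedFDeriv_le_of_hasCompactSupport hb b.hasCompactSupport N
  refine ⟨B, (norm_nonneg _).trans (hB 0 N.zero_le 0), fun ε hε => ?_⟩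
  have hnorm (x : G) : ‖ε⁻¹ • (x - a)‖ = ‖x - a‖ / ε := by
    rw [norm_smul, norm_inv, Real.norm_of_nonneg hε.le, inv_mul_eq_div]
  refine ⟨fun z => b (ε⁻¹ • (z - a)),
    hb.comp (contDiff_const.smul (contDiff_id.sub contDiff_const)), ?_, fun x hx => ?_,
    fun j hj x => ?_⟩
  · filter_upwards [Metric.ball_mem_nhds a (show 0 < 1 / 4 * ε by positivity)] with x hx
    refine b.one_of_mem_closedBall ?_
    rw [mem_closedBall_zero_iff, hnorm, div_le_iff₀ hε]
    exact (mem_ball_iff_norm.mp hx).le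
  · have hfar : ∀ᶠ z in 𝓝 x, 1 / 2 * ε < ‖z - a‖ :=
      (by fun_prop : ContinuousAt (fun z => ‖z - a‖) x).eventually_const_lt (by linarith)
    filter_upwards [hfar] with z hz
    refine b.zero_of_le_dist ?_
    rw [dist_zero_right, hnorm, le_div_iff₀ hε]
    exact hz.le
  · simpa only [abs_of_pos (inv_pos.mpr hε)] using
      norm_iteratedFDeriv_comp_smul_sub_le hb ε⁻¹ a x j (hB j hj)

theorem VanishesTo.exists_cutoff [FiniteDimensional ℝ G] {N : ℕ} {f : G → E} {a : G}
    (h : VanishesTo (N + 1) f a) (hf : ContDiffAt ℝ N f a) {δ : ℝ} (hδ : 0 < δ) :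
    ∃ χ : G → ℝ, ContDiff ℝ (⊤ : ℕ∞) χ ∧ (∀ᶠ x in 𝓝 a, χ x = 1) ∧
      ∀ x, ∀ j ≤ N, ‖iteratedFDeriv ℝ j (fun z => χ z • f z) x‖ ≤ δ := by
  obtain ⟨B, hB₀, hB⟩ := exists_contDiff_cutoff_scale a N
  obtain ⟨r, hr, hball⟩ :=
    h.exists_norm_iteratedFDeriv_le hf (η := δ / (2 ^ N * (B + 1))) (by positivity)
  have hε : 0 < min 1 r := by positivity
  obtain ⟨χ, hχ, hχ₁, hχ₀, hχB⟩ := hB _ hε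
  refine ⟨χ, hχ, hχ₁, fun x j hj => ?_⟩
  rcases lt_or_ge ‖x - a‖ (min 1 r) with hx | hx
  · obtain ⟨hfx, hfη⟩ := hball x (mem_ball_iff_norm.mpr (hx.trans_le (min_le_right _ _)))
    calc _ ≤ 2 ^ N * (B * (δ / (2 ^ N * (B + 1)))) :=
          norm_iteratedFDeriv_smul_le_of_scale hε (min_le_left _ _)
            (hχ.of_le (by exact_mod_cast le_top)).contDiffAt hfx (fun i hi => hχB i hi x)
            (fun i hi => (hfη i hi).trans (by gcongr)) hj
      _ = B / (B + 1) * δ := by field_simp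
      _ ≤ δ := mul_le_of_le_one_left hδ.le (div_le_one_of_le₀ (by linarith) (by linarith))
  · have hzero : (fun z => χ z • f z) =ᶠ[𝓝 x] 0 := (hχ₀ x hx).mono fun z hz => by simp [hz]
    rw [(hzero.iteratedFDeriv ℝ j).eq_of_nhds]
    simpa using hδ.le

theorem iteratedFDeriv_diag_sub {k : ℕ} (A : ContinuousMultilinearMap ℝ (fun _ : Fin k => G) E)
    (hA : ∀ (σ : Equiv.Perm (Fin k)) v, A (v ∘ σ) = A v) (a : G) :
    iteratedFDeriv ℝ k (fun x => A fun _ => x - a) a = (k ! : ℝ) • A := by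
  ext v
  rw [iteratedFDeriv_comp_sub (f := fun z => A fun _ => z),
    ContinuousMultilinearMap.iteratedFDeriv_comp_diagonal]
  have hsymm (σ : Equiv.Perm (Fin k)) : A (fun i => v (σ i)) = A v := hA σ v
  simp only [hsymm, Finset.sum_const, Finset.card_univ, Fintype.card_perm, Fintype.card_fin,
    smul_apply, Nat.cast_smul_eq_nsmul]

theorem vanishesTo_diag_sub {k : ℕ} (A : ContinuousMultilinearMap ℝ (fun _ : Fin k => G) E)
    (a : G) : VanishesTo k (fun x => A fun _ => x - a) a := by
  intro j hj
  set diag : G →L[ℝ] (Fin k → G) := ContinuousLinearMap.pi fun _ => ContinuousLinearMap.id ℝ G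
  change iteratedFDeriv ℝ j (fun x => (A ∘ diag) (x - a)) a = 0
  have hA : iteratedFDeriv ℝ j A 0 = 0 := by
    rw [← norm_le_zero_iff]
    exact (A.norm_iteratedFDeriv_le j 0).trans (by simp [Nat.sub_ne_zero_of_lt hj])
  rw [iteratedFDeriv_comp_sub, diag.iteratedFDeriv_comp_right A.contDiff _ le_rfl, sub_self,
    map_zero, hA]
  ext v
  simp

theorem VanishesTo.sub_taylor {k : ℕ} {f : G → E} {a : G} (h : VanishesTo k f a)
    (hf : ContDiffAt ℝ k f a) :
    VanishesTo (k + 1)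
      (fun x => f x - (k ! : ℝ)⁻¹ • iteratedFDeriv ℝ k f a (fun _ => x - a)) a := by
  set A := iteratedFDeriv ℝ k f a
  have hAcd : ContDiffAt ℝ k (fun x : G => A fun _ => x - a) a :=
    (A.contDiff.comp (contDiff_pi.2 fun _ => contDiff_id.sub contDiff_const)).contDiffAt
  intro j hj
  have hjk : (j : WithTop ℕ∞) ≤ k := by exact_mod_cast Nat.le_of_lt_succ hj
  have hsub : iteratedFDeriv ℝ j (fun x => f x - (k ! : ℝ)⁻¹ • A (fun _ => x - a)) a =
      iteratedFDeriv ℝ j f a -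
        (k ! : ℝ)⁻¹ • iteratedFDeriv ℝ j (fun x : G => A fun _ => x - a) a := by
    rw [← iteratedFDeriv_const_smul_apply (hAcd.of_le hjk)]
    exact iteratedFDeriv_sub_apply (hf.of_le hjk) ((hAcd.of_le hjk).const_smul _)
  rw [hsub]
  rcases (Nat.le_of_lt_succ hj).lt_or_eq with hlt | rfl
  · rw [h j hlt, vanishesTo_diag_sub A a j hlt, smul_zero, sub_zero]
  · rw [iteratedFDeriv_diag_sub A (iteratedFDeriv_comp_perm_of_contDiffAt hf) a,
      inv_smul_smul₀ (by positivity), sub_self]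

end Calculus

section Support

theorem zeroExt_of_notMem {G E : Type*} [NormedAddCommGroup E] {X : Set G} (f : X → E) {x : G}
    (hx : x ∉ X) : zeroExt f x = 0 :=
  Function.extend_apply' _ _ _ fun ⟨a, ha⟩ => hx (ha ▸ a.2)

variable {G : Type*} [NormedAddCommGroup G] [NormedSpace ℝ G]
variable {H : Type*} [NormedAddCommGroup H] [NormedSpace ℝ H]
variable {E : Type*} [NormedAddCommGroup E] [NormedSpace ℝ E]
variable {F : Type*} [NormedAddCommGroup F] [NormedSpace ℝ F]
variable {p q : ℕ∞} {X : Opens G} {Y : Opens H}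

/-- The ring of smooth scalar functions on `G`, which acts on `C^p(X, E)` by multiplication. -/
def Smooth (G : Type*) [NormedAddCommGroup G] [NormedSpace ℝ G] : Subalgebra ℝ (G → ℝ) where
  carrier := {χ | ContDiff ℝ (⊤ : ℕ∞) χ}
  mul_mem' {χ ξ} hχ hξ := by
    simp only [mem_ofPred_eq] at hχ hξ ⊢
    exact hχ.mul hξ
  add_mem' {χ ξ} hχ hξ := by
    simp only [mem_ofPred_eq] at hχ hξ ⊢
    exact hχ.add hξ
  algebraMap_mem' c := by
    simp only [mem_ofPred_eq]
    exact contDiff_const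

namespace Smooth

theorem mem_iff {χ : G → ℝ} : χ ∈ Smooth G ↔ ContDiff ℝ (⊤ : ℕ∞) χ := Iff.rfl

theorem contDiff (χ : Smooth G) (m : ℕ∞) : ContDiff ℝ m (χ : G → ℝ) :=
  (mem_iff.mp χ.2).of_le (by exact_mod_cast le_top)

end Smooth

namespace Ck

@[ext] theorem ext {f g : Ck p X E} (h : ∀ x, f x = g x) : f = g := Subtype.ext (funext h)

@[simp] theorem sub_apply (f g : Ck p X E) (x : X) : (f - g) x = f x - g x := rfl

@[simp] theorem smul_apply (c : ℝ) (f : Ck p X E) (x : X) : (c • f) x = c • f x := rfl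

theorem zeroExt_eventuallyEq {f : Ck p X E} {g : G → E} (h : ∀ x : X, f x = g x) {x : G}
    (hx : x ∈ X) : zeroExt (X := (X : Set G)) f =ᶠ[𝓝 x] g := by
  filter_upwards [X.isOpen.mem_nhds hx] with z hz
  exact (zeroExt_apply (X := (X : Set G)) f ⟨z, hz⟩).trans (h ⟨z, hz⟩)

theorem contDiffAt_natCast (f : Ck p X E) {k : ℕ} (hk : (k : ℕ∞) ≤ p) (x : X) :
    ContDiffAt ℝ k (zeroExt (X := (X : Set G)) f) x :=
  (f.contDiffAt x.2).of_le (by exact_mod_cast hk)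

theorem continuous (f : Ck p X E) : Continuous f := by
  have h : ContinuousOn (zeroExt (X := (X : Set G)) f) X := (f.2 : ContDiffOn ℝ _ _ _).continuousOn
  exact (continuousOn_iff_continuous_domRestrict.mp h).congr (zeroExt_apply (X := (X : Set G)) f)

/-- The constant function with value `u` on `X`. -/
def const (p : ℕ∞) (X : Opens G) (u : E) : Ck p X E :=
  ⟨fun _ => u, (contDiff_const (c := u)).contDiffOn.congr fun x hx => zeroExt_apply _ ⟨x, hx⟩⟩

@[simp] theorem const_apply (u : E) (x : X) : const p X u x = u := rfl

instance : SMul (Smooth G) (Ck p X E) where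
  smul χ f := ⟨fun x => χ.1 x • f x,
    ((Smooth.contDiff χ p).contDiffOn.smul (f.2 : ContDiffOn ℝ _ _ _)).congr fun x hx => by
      rw [zeroExt_apply _ ⟨x, hx⟩]
      exact congrArg (χ.1 x • ·) (zeroExt_apply (X := (X : Set G)) f ⟨x, hx⟩).symm⟩

@[simp] theorem smooth_smul_apply (χ : Smooth G) (f : Ck p X E) (x : X) :
    (χ • f) x = χ.1 x • f x := rfl

instance : Module (Smooth G) (Ck p X E) where
  one_smul f := by ext x; exact one_smul ℝ (f x)
  mul_smul χ ξ f := by ext x; exact mul_smul (χ.1 x) (ξ.1 x) (f x)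
  smul_zero χ := by ext x; exact smul_zero (χ.1 x)
  smul_add χ f g := by ext x; exact smul_add (χ.1 x) (f x) (g x)
  add_smul χ ξ f := by ext x; exact add_smul (χ.1 x) (ξ.1 x) (f x)
  zero_smul f := by ext x; exact zero_smul ℝ (f x)

instance : IsScalarTower ℝ (Smooth G) (Ck p X E) where
  smul_assoc c χ f := by ext x; exact smul_assoc c (χ.1 x) (f x)

theorem zeroExt_smooth_smul (χ : Smooth G) (f : Ck p X E) :
    zeroExt (X := (X : Set G)) (χ • f : Ck p X E) =
      fun x => χ.1 x • zeroExt (X := (X : Set G)) f x := by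
  funext x
  by_cases hx : x ∈ (X : Set G)
  · rw [zeroExt_apply _ ⟨x, hx⟩, zeroExt_apply (X := (X : Set G)) f ⟨x, hx⟩]
    rfl
  · rw [zeroExt_of_notMem _ hx, zeroExt_of_notMem (X := (X : Set G)) f hx, smul_zero]

/-- Evaluation at a point of `X`, as a linear map on `C^p(X, E)`. -/
def eval (x : X) : Ck p X E →ₗ[ℝ] E where
  toFun f := f x
  map_add' _ _ := rfl
  map_smul' _ _ := rfl

end Ck

/-- The vector-valued functional `f ↦ T f y`. -/
def evalComp (T : Ck p X E →L[ℝ] Ck q Y F) (y : Y) : Ck p X E →ₗ[ℝ] F :=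
  Ck.eval y ∘ₗ T.toLinearMap

@[simp] theorem evalComp_apply (T : Ck p X E →L[ℝ] Ck q Y F) (y : Y) (f : Ck p X E) :
    evalComp T y f = T f y := rfl

theorem norm_D_le_rho (i : SeminormIndex p X) (f : Ck p X E) {x : G} (hx : x ∈ i.1.1) {j : ℕ}
    (hj : j ≤ i.2.1) : ‖Ck.D j f x‖ ≤ rho p X E i f :=
  le_ciSup (bddAbove_D i f) (⟨x, hx⟩, ⟨j, Nat.lt_succ_of_le hj⟩)

theorem norm_le_rho (i : SeminormIndex p X) (f : Ck p X E) {x : X} (hx : (x : G) ∈ i.1.1) :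
    ‖f x‖ ≤ rho p X E i f := by
  have h := norm_D_le_rho i f hx (Nat.zero_le _)
  rwa [Ck.D, norm_iteratedFDeriv_zero, zeroExt_apply (X := (X : Set G)) f x] at h

theorem rho_le {i : SeminormIndex p X} {f : Ck p X E} {δ : ℝ} (hδ : 0 ≤ δ)
    (h : ∀ x ∈ i.1.1, ∀ j ≤ i.2.1, ‖Ck.D j f x‖ ≤ δ) : rho p X E i f ≤ δ :=
  Real.iSup_le (fun a => h a.1 a.1.2 a.2 (Nat.lt_succ_iff.mp a.2.2)) hδ

theorem rho_mono {i j : SeminormIndex p X} (h₁ : i.1.1 ⊆ j.1.1) (h₂ : i.2 ≤ j.2) :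
    rho p X E i ≤ rho p X E j := fun f =>
  rho_le (apply_nonneg _ f) fun _ hx _ hk => norm_D_le_rho j f (h₁ hx) (hk.trans h₂)

theorem directed_rho : Directed (· ≤ ·) (rho p X E) := fun i j =>
  ⟨(⟨i.1.1 ∪ j.1.1, i.1.2.1.union j.1.2.1, union_subset i.1.2.2 j.1.2.2⟩, max i.2 j.2),
    rho_mono subset_union_left (le_max_left _ _), rho_mono subset_union_right (le_max_right _ _)⟩

theorem exists_norm_apply_le_mul_rho (T : Ck p X E →L[ℝ] Ck q Y F) {L : Set Y}
    (hL : IsCompact L) :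
    ∃ (i : SeminormIndex p X) (C : ℝ), 0 ≤ C ∧
      ∀ y ∈ L, ∀ f, ‖evalComp T y f‖ ≤ C * rho p X E i f := by
  let i₀ : SeminormIndex q Y :=
    (⟨Subtype.val '' L, hL.image continuous_subtype_val, Subtype.coe_image_subset _ L⟩,
      ⟨0, by simp⟩)
  have hcont : Continuous ((rho q Y F i₀).comp T.toLinearMap) :=
    (withSeminorms_rho.continuous_seminorm i₀).comp T.continuous
  obtain ⟨s, C, -, hC⟩ := Seminorm.bound_of_continuous withSeminorms_rho _ hcont
  obtain ⟨i, hi⟩ := (directed_rho (p := p) (X := X) (E := E)).finset_le s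
  refine ⟨i, C, C.2, fun y hy f => ?_⟩
  calc ‖T f y‖ ≤ rho q Y F i₀ (T f) := norm_le_rho i₀ (T f) (mem_image_of_mem _ hy)
    _ ≤ C * (s.sup (rho p X E)) f := hC f
    _ ≤ C * rho p X E i f := by gcongr; exact Finset.sup_le hi f

/-- `x` lies in the support of the functional `Λ`: every neighbourhood of `x` carries a function
on which `Λ` does not vanish. -/
def IsSupportPt (Λ : Ck p X E →ₗ[ℝ] F) (x : X) : Prop :=
  ∀ W ∈ 𝓝 x, ∃ f : Ck p X E, Function.support f ⊆ W ∧ Λ f ≠ 0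

/-- `Λ f` only depends on the germ of `f` at `x`. -/
def IsLocalAt (Λ : Ck p X E →ₗ[ℝ] F) (x : X) : Prop :=
  ∀ f : Ck p X E, (∀ᶠ z in 𝓝 x, f z = 0) → Λ f = 0

/-- `Λ` is a functional of order at most `N ≤ p` concentrated at `x`: it vanishes on the functions
whose derivatives of order at most `N` vanish at `x`. -/
def HasOrderLE (Λ : Ck p X E →ₗ[ℝ] F) (x : X) (N : ℕ) : Prop :=
  (N : ℕ∞) ≤ p ∧
    ∀ f : Ck p X E, VanishesTo (N + 1) (zeroExt (X := (X : Set G)) f) (x : G) → Λ f = 0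

section Existence

variable {Λ : Ck p X E →ₗ[ℝ] F}

theorem exists_cutoff_of_not_isSupportPt [FiniteDimensional ℝ G] {x : X}
    (hx : ¬IsSupportPt Λ x) :
    ∃ χ : Smooth G, (∀ᶠ z in 𝓝 (x : G), χ.1 z = 0) ∧ ∀ f, Λ (χ • f) = Λ f := by
  simp only [IsSupportPt, not_forall, not_exists, not_and, not_not] at hx
  obtain ⟨W, hW, hΛ⟩ := hx
  obtain ⟨O, hO, hOW⟩ := mem_nhds_induced _ _ _ |>.mp hW
  obtain ⟨r, hr, hrO⟩ := Metric.nhds_basis_ball.mem_iff.mp hO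
  let b : ContDiffBump (x : G) := ⟨r / 2, r, by positivity, by linarith⟩
  let ξ : Smooth G := ⟨b, Smooth.mem_iff.mpr b.contDiff⟩
  refine ⟨1 - ξ, b.eventuallyEq_one.mono fun z hz => sub_eq_zero.mpr hz.symm, fun f => ?_⟩
  have hξ : Λ (ξ • f) = 0 := by
    refine hΛ _ fun z hz => hOW (hrO ?_)
    rw [← b.support_eq]
    exact left_ne_zero_of_smul (Function.mem_support.mp hz)
  rw [sub_smul, one_smul, map_sub, hξ, sub_zero]

theorem exists_cutoff_of_isCompact [FiniteDimensional ℝ G] (hΛ : ∀ x, ¬IsSupportPt Λ x)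
    {K : Set G} (hK : IsCompact K) (hKX : K ⊆ X) :
    ∃ χ : Smooth G, (∀ x ∈ K, ∀ᶠ z in 𝓝 x, χ.1 z = 0) ∧ ∀ f, Λ (χ • f) = Λ f := by
  refine hK.induction_on
    (p := fun S => ∃ χ : Smooth G, (∀ x ∈ S, ∀ᶠ z in 𝓝 x, χ.1 z = 0) ∧ ∀ f, Λ (χ • f) = Λ f)
    ⟨1, by simp, by simp⟩ ?_ ?_ fun x hx => ?_
  · rintro S S' hSS' ⟨χ, hχ, hΛχ⟩
    exact ⟨χ, fun x hx => hχ x (hSS' hx), hΛχ⟩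
  · rintro S S' ⟨χ, hχ, hΛχ⟩ ⟨ξ, hξ, hΛξ⟩
    refine ⟨χ * ξ, ?_, fun f => by rw [mul_smul, hΛχ, hΛξ]⟩
    rintro x (hx | hx)
    · exact (hχ x hx).mono fun z hz => mul_eq_zero_of_left hz _
    · exact (hξ x hx).mono fun z hz => mul_eq_zero_of_right _ hz
  · obtain ⟨χ, hχ, hΛχ⟩ := exists_cutoff_of_not_isSupportPt (hΛ ⟨x, hKX hx⟩)
    exact ⟨_, mem_nhdsWithin_of_mem_nhds (eventually_eventually_nhds.mpr hχ), χ,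
      fun _ hz => hz, hΛχ⟩

theorem exists_isSupportPt [FiniteDimensional ℝ G] {i : SeminormIndex p X} {C : ℝ}
    (hΛ : ∀ f, ‖Λ f‖ ≤ C * rho p X E i f) (h₀ : ∃ f, Λ f ≠ 0) :
    ∃ x, IsSupportPt Λ x := by
  by_contra! hno
  obtain ⟨f, hf⟩ := h₀
  obtain ⟨χ, hχ, hΛχ⟩ := exists_cutoff_of_isCompact hno i.1.2.1 i.1.2.2
  have hrho : rho p X E i (χ • f) = 0 := by
    refine (rho_le le_rfl fun x hx j _ => ?_).antisymm (apply_nonneg _ _)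
    have hzero : zeroExt (X := (X : Set G)) (χ • f : Ck p X E) =ᶠ[𝓝 x] 0 := by
      rw [Ck.zeroExt_smooth_smul]
      filter_upwards [hχ x hx] with z hz
      rw [hz, zero_smul, Pi.zero_apply]
    rw [Ck.D, (hzero.iteratedFDeriv ℝ j).eq_of_nhds]
    simp
  have hbound := hΛ (χ • f)
  rw [hΛχ, hrho, mul_zero] at hbound
  exact hf (norm_le_zero_iff.mp hbound)

theorem IsSupportPt.isLocalAt {x : X} (hx : IsSupportPt Λ x)
    (hΛ : ∀ f g : Ck p X E, DisjointFun f g → Λ f = 0 ∨ Λ g = 0) : IsLocalAt Λ x := by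
  intro f hf
  obtain ⟨g, hg, hΛg⟩ := hx _ hf
  refine (hΛ f g fun z => ?_).resolve_right hΛg
  exact or_iff_not_imp_right.mpr fun hz => hg hz

theorem IsLocalAt.mem_closure_support {x : X} (hΛ : IsLocalAt Λ x) {f : Ck p X E}
    (hf : Λ f ≠ 0) : x ∈ closure {z | f z ≠ 0} :=
  mem_closure_iff_frequently.mpr fun h => hf (hΛ f (h.mono fun _ => not_not.mp))

theorem IsLocalAt.hasOrderLE [FiniteDimensional ℝ G] {x : X} (hloc : IsLocalAt Λ x)
    {i : SeminormIndex p X} {C : ℝ} (hC : 0 ≤ C) (hΛ : ∀ f, ‖Λ f‖ ≤ C * rho p X E i f) :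
    HasOrderLE Λ x i.2 := by
  refine ⟨i.2.2, fun f hf => ?_⟩
  have hle (δ : ℝ) (hδ : 0 < δ) : ‖Λ f‖ ≤ C * δ := by
    obtain ⟨χ, hχ, hχ₁, hχδ⟩ := hf.exists_cutoff (f.contDiffAt_natCast i.2.2 x) hδ
    have hgerm : Λ ((⟨χ, Smooth.mem_iff.mpr hχ⟩ : Smooth G) • f - f) = 0 := by
      refine hloc _ ((continuous_subtype_val.tendsto x).eventually hχ₁ |>.mono fun z hz => ?_)
      simp [hz]
    rw [map_sub, sub_eq_zero] at hgerm
    rw [← hgerm]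
    refine (hΛ _).trans (mul_le_mul_of_nonneg_left (rho_le hδ.le fun z _ j hj => ?_) hC)
    rw [Ck.D, Ck.zeroExt_smooth_smul]
    exact hχδ z j hj
  have hlim : Tendsto (fun δ => C * δ) (𝓝[>] 0) (𝓝 0) :=
    ((continuous_const_mul C).tendsto' 0 0 (mul_zero C)).mono_left nhdsWithin_le_nhds
  exact norm_le_zero_iff.mp (ge_of_tendsto hlim (eventually_nhdsWithin_of_forall hle))

end Existence

theorem continuous_emb : Continuous (emb p X) :=
  Continuous.subtype_mk (continuous_pi fun f => OnePoint.continuous_coe.comp f.continuous) _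

section SupportMap

variable {T : Ck p X E →L[ℝ] Ck q Y F} {h : Y → X}

theorem exists_isSupportPt_evalComp [FiniteDimensional ℝ G] (T : Ck p X E →L[ℝ] Ck q Y F) {y : Y}
    (hy : ∃ f, T f y ≠ 0) : ∃ x, IsSupportPt (evalComp T y) x := by
  obtain ⟨i, C, -, hT⟩ := exists_norm_apply_le_mul_rho T (isCompact_singleton (x := y))
  exact exists_isSupportPt (hT y rfl) hy

theorem IsSeparating.isLocalAt (hsep : IsSeparating T) {y : Y} {x : X}
    (hx : IsSupportPt (evalComp T y) x) : IsLocalAt (evalComp T y) x :=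
  hx.isLocalAt fun f g hfg => hsep f g hfg y

theorem IsSupportPt.mem_openFamily [FiniteDimensional ℝ G] {y : Y} {x : X}
    (hx : IsSupportPt (evalComp T y) x) {U : Set (Compactif p X)} (hU : IsOpen U)
    (hxU : emb p X x ∈ U) : U ∈ openFamily T y := by
  have : ProperSpace G := FiniteDimensional.proper ℝ G
  have : LocallyCompactSpace X := X.isOpen.locallyCompactSpace
  obtain ⟨B, hBx, hBU, hB⟩ := local_compact_nhds ((hU.preimage continuous_emb).mem_nhds hxU)
  obtain ⟨f, hfB, hf⟩ := hx B hBx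
  refine ⟨hU, f, hf, ?_⟩
  calc suppClosure f ⊆ emb p X '' B :=
        closure_minimal (image_mono hfB) (hB.image continuous_emb).isClosed
    _ ⊆ U := image_subset_iff.mpr hBU

theorem IsLocalAt.emb_mem_of_mem_openFamily {y : Y} {x : X} (hx : IsLocalAt (evalComp T y) x)
    {U : Set (Compactif p X)} (hU : U ∈ openFamily T y) : emb p X x ∈ U := by
  obtain ⟨-, f, hf, hfU⟩ := hU
  exact hfU (image_closure_subset_closure_image continuous_emb
    (mem_image_of_mem _ (hx.mem_closure_support hf)))

theorem isSupportMap_of_isSupportPt [FiniteDimensional ℝ G] (hsep : IsSeparating T)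
    (hh : ∀ y, IsSupportPt (evalComp T y) (h y)) : IsSupportMap T h := by
  refine fun y => Subset.antisymm (fun z hz => ?_) (singleton_subset_iff.mpr ?_)
  · by_contra hne
    obtain ⟨U, V, hU, hV, hxU, hzV, hUV⟩ := t2_separation (Ne.symm hne)
    have hzU : z ∈ closure U := mem_iInter₂.mp hz U ((hh y).mem_openFamily hU hxU)
    exact (hUV.closure_left hV).notMem_of_mem_left hzU hzV
  · exact mem_iInter₂.mpr fun U hU =>
      subset_closure ((hsep.isLocalAt (hh y)).emb_mem_of_mem_openFamily hU)

theorem continuous_of_isSupportPt (hsep : IsSeparating T)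
    (hh : ∀ y, IsSupportPt (evalComp T y) (h y)) : Continuous h := by
  refine continuous_iff_continuousAt.mpr fun y W hW => ?_
  obtain ⟨B, hB, hBc, hBW⟩ := exists_mem_nhds_isClosed_subset hW
  obtain ⟨f, hfB, hf⟩ := hh y B hB
  rw [mem_map]
  filter_upwards [(T f).continuous.continuousAt.eventually_ne hf] with z hz
  exact hBW (closure_minimal hfB hBc ((hsep.isLocalAt (hh z)).mem_closure_support hz))

theorem exists_eventually_of_forall_isCompact {Z : Type*} [TopologicalSpace Z]
    [FirstCountableTopology Z] {ι : Type*} [Countable ι] {P : ι → Z → Prop}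
    (hP : ∀ L, IsCompact L → ∃ i, ∀ z ∈ L, P i z) (z₀ : Z) : ∃ i, ∀ᶠ z in 𝓝 z₀, P i z := by
  by_contra! hno
  obtain ⟨i₀, -⟩ := hP ∅ isCompact_empty
  have : Nonempty ι := ⟨i₀⟩
  obtain ⟨e, he⟩ := exists_surjective_nat ι
  obtain ⟨B, hB⟩ := (𝓝 z₀).exists_antitone_basis
  have hex (k : ℕ) : ∃ z ∈ B k, ¬P (e k) z :=
    ((hno (e k)).and_eventually (hB.mem k)).exists.imp fun _ hz => hz.symm
  choose z hzB hz using hex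
  obtain ⟨i, hi⟩ := hP _ (hB.tendsto hzB).isCompact_insert_range
  obtain ⟨k, rfl⟩ := he i
  exact hz k (hi _ (mem_insert_of_mem _ (mem_range_self k)))

theorem eventually_hasOrderLE [FiniteDimensional ℝ G] (hsep : IsSeparating T)
    (hh : ∀ y, IsSupportPt (evalComp T y) (h y)) (y₀ : Y) :
    ∃ N, ∀ᶠ y in 𝓝 y₀, HasOrderLE (evalComp T y) (h y) N := by
  refine exists_eventually_of_forall_isCompact (fun L hL => ?_) y₀
  obtain ⟨i, C, hC, hT⟩ := exists_norm_apply_le_mul_rho T hL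
  exact ⟨i.2, fun y hy => (hsep.isLocalAt (hh y)).hasOrderLE hC (hT y hy)⟩

end SupportMap

end Support

section Monomials

variable {n : ℕ} {E : Type*} [NormedAddCommGroup E] [NormedSpace ℝ E]
variable {F : Type*} [NormedAddCommGroup F] [NormedSpace ℝ F]
variable {p : ℕ∞} {X : Opens (EuclideanSpace ℝ (Fin n))}

/-- The `i`-th coordinate, as an element of the ring of smooth functions. -/
def coord (i : Fin n) : Smooth (EuclideanSpace ℝ (Fin n)) :=
  ⟨fun x => x i, Smooth.mem_iff.mpr (by fun_prop)⟩

/-- The monomial `x ↦ (x - a)^l` centred at `a`, as an element of the ring of smooth functions. -/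
def monomialAt (a : EuclideanSpace ℝ (Fin n)) (l : Fin n → ℕ) :
    Smooth (EuclideanSpace ℝ (Fin n)) :=
  ∏ i, (coord i - algebraMap ℝ _ (a i)) ^ l i

theorem coe_monomialAt (a : EuclideanSpace ℝ (Fin n)) (l : Fin n → ℕ) :
    (monomialAt a l : EuclideanSpace ℝ (Fin n) → ℝ) = ∏ i, (fun x => x i - a i) ^ l i := by
  change (Smooth _).val _ = _
  simp only [monomialAt, map_prod, map_pow]
  rfl

theorem monomialAt_apply (a x : EuclideanSpace ℝ (Fin n)) (l : Fin n → ℕ) :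
    (monomialAt a l).1 x = ∏ i, (x i - a i) ^ l i := by
  rw [coe_monomialAt, Finset.prod_apply]
  rfl

theorem monomialAt_zero (a : EuclideanSpace ℝ (Fin n)) : monomialAt a 0 = 1 := by
  simp [monomialAt]

theorem monomialAt_add (a : EuclideanSpace ℝ (Fin n)) (l s : Fin n → ℕ) :
    monomialAt a (l + s) = monomialAt a l * monomialAt a s := by
  simp only [monomialAt, Pi.add_apply, pow_add, Finset.prod_mul_distrib]

theorem monomialAt_single (a : EuclideanSpace ℝ (Fin n)) (i : Fin n) (m : ℕ) :
    monomialAt a (Pi.single i m) = (coord i - algebraMap ℝ _ (a i)) ^ m := by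
  rw [monomialAt, Fintype.prod_eq_single i fun j hj => by rw [Pi.single_eq_of_ne hj, pow_zero],
    Pi.single_eq_same]

theorem vanishesTo_monomialAt (a : EuclideanSpace ℝ (Fin n)) (l : Fin n → ℕ) :
    VanishesTo (order l) (monomialAt a l).1 a := by
  rw [coe_monomialAt]
  have hψ (i : Fin n) :
      ContDiff ℝ (⊤ : ℕ∞) fun x : EuclideanSpace ℝ (Fin n) => x i - a i := by fun_prop
  have hone (i : Fin n) :
      VanishesTo 1 (fun x : EuclideanSpace ℝ (Fin n) => x i - a i) a :=
    vanishesTo_one_iff.mpr (sub_self (a i))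
  exact .prod (fun i => (hψ i).pow _) (fun i => (hone i).pow (hψ i) _) _

theorem powFun_symMono (a : EuclideanSpace ℝ (Fin n)) (l : Fin n → ℕ) (u : E) :
    powFun p X (symMono l u) a = monomialAt a l • Ck.const p X u := by
  ext x
  rw [Ck.smooth_smul_apply, Ck.const_apply, monomialAt_apply]
  exact symMono_diag l u (x - a)

theorem multilinear_diag_eq_sum {k : ℕ}
    (A : ContinuousMultilinearMap ℝ (fun _ : Fin k => EuclideanSpace ℝ (Fin n)) E)
    (v : EuclideanSpace ℝ (Fin n)) :
    A (fun _ => v) = ∑ c : Fin k → Fin n, (∏ i, v i ^ Finset.card {j | c j = i}) •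
      A fun j => EuclideanSpace.basisFun (Fin n) ℝ (c j) := by
  conv_lhs => rw [← (EuclideanSpace.basisFun (Fin n) ℝ).sum_repr v]
  rw [ContinuousMultilinearMap.map_sum]
  refine Finset.sum_congr rfl fun c _ => ?_
  rw [ContinuousMultilinearMap.map_smul_univ]
  congr 1
  simp only [← Finset.prod_const]
  exact (Finset.prod_fiberwise' Finset.univ c fun i => v i).symm

theorem powFun_eq_sum {k : ℕ} (S : SymForm k (EuclideanSpace ℝ (Fin n)) E)
    (a : EuclideanSpace ℝ (Fin n)) :
    powFun p X S a = ∑ c : Fin k → Fin n, monomialAt a (fun i => Finset.card {j | c j = i}) •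
      Ck.const p X (S.1 fun j => EuclideanSpace.basisFun (Fin n) ℝ (c j)) := by
  ext x
  refine Eq.trans ?_ (map_sum (Ck.eval x) _ _).symm
  refine (multilinear_diag_eq_sum S.1 (x - a)).trans (Finset.sum_congr rfl fun c _ => ?_)
  change _ = (monomialAt a _).1 x • (_ : E)
  rw [monomialAt_apply]
  rfl

namespace HasOrderLE

variable {Λ : Ck p X E →ₗ[ℝ] F} {x : X} {N : ℕ}

theorem map_smul_eq_zero (hN : HasOrderLE Λ x N)
    {χ : Smooth (EuclideanSpace ℝ (Fin n))} {f : Ck p X E} {k l : ℕ} (hχ : VanishesTo k χ.1 x)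
    (hf : VanishesTo l (zeroExt (X := (X : Set (EuclideanSpace ℝ (Fin n)))) f) x)
    (hkl : k + l = N + 1) : Λ (χ • f) = 0 := by
  refine hN.2 _ ?_
  rw [Ck.zeroExt_smooth_smul, ← hkl]
  exact hχ.smul hf (Smooth.contDiff χ N).contDiffAt
    (f.contDiffAt_natCast hN.1 x) hkl.le

theorem map_monomialAt_smul_eq_zero_of_lt (hN : HasOrderLE Λ x N) {l : Fin n → ℕ}
    (hl : N < order l) (f : Ck p X E) : Λ (monomialAt x l • f) = 0 :=
  hN.map_smul_eq_zero ((vanishesTo_monomialAt _ l).mono hl) (.zero _ _) rfl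

/-- Descending induction on the order to which `f` vanishes at `x`, the leading term of the Taylor
expansion being a combination of centred monomials. -/
theorem map_monomialAt_smul_eq_zero (hN : HasOrderLE Λ x N) {s : Fin n → ℕ}
    (hs : ∀ l, s ≤ l → (order l : ℕ∞) ≤ p → ∀ u, Λ (monomialAt x l • Ck.const p X u) = 0)
    (f : Ck p X E) : Λ (monomialAt x s • f) = 0 := by
  have hmono (l : Fin n → ℕ) (u : E) :
      Λ (monomialAt x s • monomialAt x l • Ck.const p X u) = 0 := by
    rw [smul_smul, ← monomialAt_add]
    rcases le_or_gt (order (s + l)) N with h | h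
    · exact hs _ le_self_add (le_trans (by exact_mod_cast h) hN.1) u
    · exact hN.map_monomialAt_smul_eq_zero_of_lt h _
  suffices h : ∀ k ≤ N + 1, ∀ f : Ck p X E,
      VanishesTo k (zeroExt (X := (X : Set (EuclideanSpace ℝ (Fin n)))) f) x →
        Λ (monomialAt x s • f) = 0 from h 0 (Nat.zero_le _) f (.zero _ _)
  intro k hk
  induction hk using Nat.decreasingInduction with
  | self => exact fun f hf => hN.map_smul_eq_zero (.zero _ _) hf (zero_add _)
  | of_succ k hk ih =>
    intro f hf
    have hkp : (k : ℕ∞) ≤ p := le_trans (by exact_mod_cast Nat.le_of_lt_succ hk) hN.1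
    have hfk := f.contDiffAt_natCast hkp x
    let S : SymForm k (EuclideanSpace ℝ (Fin n)) E :=
      ⟨_, iteratedFDeriv_comp_perm_of_contDiffAt hfk⟩
    have hS : Λ (monomialAt x s • powFun p X S x) = 0 := by
      rw [powFun_eq_sum, Finset.smul_sum, map_sum]
      exact Finset.sum_eq_zero fun c _ => hmono _ _
    have hsub := ih (f - (k ! : ℝ)⁻¹ • powFun p X S x)
      ((hf.sub_taylor hfk).congr (Ck.zeroExt_eventuallyEq (fun z => ?_) x.2).symm)
    · rwa [smul_sub, smul_comm, map_sub, map_smul Λ (k ! : ℝ)⁻¹, hS, smul_zero, sub_zero] at hsub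
    · rw [zeroExt_apply (X := (X : Set (EuclideanSpace ℝ (Fin n)))) f z]
      rfl

end HasOrderLE

end Monomials

section Regularity

theorem contDiffAt_of_eventually_eq_zero {H A : Type*} [NormedAddCommGroup H] [NormedSpace ℝ H]
    [NormedAddCommGroup A] [NormedSpace ℝ A] [CompleteSpace A] {q : ℕ∞} {Φ : A × ℝ → ℝ}
    (hΦ : ContDiff ℝ (⊤ : ℕ∞) Φ) {a : H → A} {t : H → ℝ} {z₀ : H} (ha : ContDiffAt ℝ q a z₀)
    (ht : ContinuousAt t z₀) (h₀ : ∀ᶠ z in 𝓝 z₀, Φ (a z, t z) = 0) {d : ℝ}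
    (hd : HasDerivAt (fun s => Φ (a z₀, s)) d (t z₀)) (hd₀ : d ≠ 0) : ContDiffAt ℝ q t z₀ := by
  have hcd : ContDiffAt ℝ (⊤ : ℕ∞) Φ (a z₀, t z₀) := hΦ.contDiffAt
  have htop : ((⊤ : ℕ∞) : WithTop ℕ∞) ≠ 0 := by simp
  have hinr : fderiv ℝ Φ (a z₀, t z₀) ∘L .inr ℝ A ℝ =
      (ContinuousLinearEquiv.unitsEquivAut ℝ (Units.mk0 d hd₀) : ℝ →L[ℝ] ℝ) := by
    have hcomp : HasDerivAt (fun s => Φ (a z₀, s)) (fderiv ℝ Φ (a z₀, t z₀) (0, 1)) (t z₀) :=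
      (hcd.differentiableAt htop).hasFDerivAt.comp_hasDerivAt _
        ((hasDerivAt_const _ _).prodMk (hasDerivAt_id _))
    ext
    simpa using hcomp.unique hd
  have hinv : (fderiv ℝ Φ (a z₀, t z₀) ∘L .inr ℝ A ℝ).IsInvertible := ⟨_, hinr.symm⟩
  have heq : t =ᶠ[𝓝 z₀] hcd.implicitFunction htop hinv ∘ a := by
    filter_upwards [h₀, (ha.continuousAt.prodMk ht).eventually
      (hcd.eventually_apply_eq_iff_implicitFunction htop hinv)] with z hz hiff
    exact (hiff.mp (hz.trans h₀.self_of_nhds.symm)).symm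
  refine ContDiffAt.congr_of_eventuallyEq ?_ heq
  exact ((hcd.contDiffAt_implicitFunction htop hinv).of_le (by exact_mod_cast le_top)).comp z₀ ha

theorem contDiffAt_of_sum_mul_pow_eq_zero {H : Type*} [NormedAddCommGroup H] [NormedSpace ℝ H]
    {q : ℕ∞} {m : ℕ} {c : Fin m → H → ℝ} {t : H → ℝ} {z₀ : H} (hc : ∀ j, ContDiffAt ℝ q (c j) z₀)
    (ht : ContinuousAt t z₀) (h₀ : ∀ᶠ z in 𝓝 z₀, ∑ j, c j z * t z ^ (j : ℕ) = 0) {d : ℝ}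
    (hd : HasDerivAt (fun s => ∑ j, c j z₀ * s ^ (j : ℕ)) d (t z₀)) (hd₀ : d ≠ 0) :
    ContDiffAt ℝ q t z₀ :=
  contDiffAt_of_eventually_eq_zero (Φ := fun v : (Fin m → ℝ) × ℝ => ∑ j, v.1 j * v.2 ^ (j : ℕ))
    (by fun_prop) (contDiffAt_pi.mpr hc) ht h₀ hd hd₀

variable {R M : Type*} [CommRing R] [Algebra ℝ R] [AddCommGroup M] [Module ℝ M] [Module R M]
  [IsScalarTower ℝ R M]

theorem sub_algebraMap_pow_smul_eq_sum (χ : R) (f : M) (s : ℝ) (m : ℕ) :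
    (χ - algebraMap ℝ R s) ^ m • f =
      ∑ j : Fin (m + 1), s ^ (j : ℕ) • ((-1) ^ (j : ℕ) * m.choose j : ℝ) • χ ^ (m - j) • f := by
  rw [sub_eq_neg_add, add_pow, Finset.sum_smul, Finset.sum_range]
  refine Finset.sum_congr rfl fun j _ => ?_
  rw [smul_smul, ← algebraMap_smul R (_ : ℝ) (χ ^ (m - j) • f), smul_smul]
  congr 1
  rw [neg_pow, ← map_pow]
  simp only [map_mul, map_pow, map_neg, map_one, map_natCast]
  ring

theorem sub_algebraMap_pow_succ_smul (χ : R) (f : M) (s : ℝ) (m : ℕ) :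
    (χ - algebraMap ℝ R s) ^ (m + 1) • f =
      (χ - algebraMap ℝ R s) ^ m • χ • f - s • (χ - algebraMap ℝ R s) ^ m • f := by
  rw [pow_succ, mul_smul, sub_smul, algebraMap_smul, smul_sub, smul_comm s]

theorem hasDerivAt_map_sub_algebraMap_pow_smul (Λ : M →ₗ[ℝ] ℝ) (χ : R) (f : M) (m : ℕ) (s : ℝ) :
    HasDerivAt (fun s => Λ ((χ - algebraMap ℝ R s) ^ (m + 1) • f))
      (-(m + 1) * Λ ((χ - algebraMap ℝ R s) ^ m • f)) s := by
  induction m generalizing f with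
  | zero =>
    have h := (hasDerivAt_const s (Λ (χ • f))).sub ((hasDerivAt_id s).mul_const (Λ f))
    refine (h.congr_deriv (by simp)).congr_of_eventuallyEq (.of_forall fun r => ?_)
    simp [sub_smul]
  | succ m ih =>
    have h := (ih (χ • f)).sub ((hasDerivAt_id s).mul (ih f))
    refine (h.congr_deriv ?_).congr_of_eventuallyEq (.of_forall fun r => ?_)
    · simp only [sub_algebraMap_pow_succ_smul χ f s m, map_sub, map_smul, smul_eq_mul, id]
      push_cast
      ring
    · simp only [sub_algebraMap_pow_succ_smul χ f r (m + 1), map_sub]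
      simp

end Regularity

section GoodSet

variable {n : ℕ} {H : Type*} [NormedAddCommGroup H] [NormedSpace ℝ H]
variable {E : Type*} [NormedAddCommGroup E] [NormedSpace ℝ E]
variable {F : Type*} [NormedAddCommGroup F] [NormedSpace ℝ F]
variable {p q : ℕ∞} {X : Opens (EuclideanSpace ℝ (Fin n))} {Y : Opens H}
variable {T : Ck p X E →L[ℝ] Ck q Y F} {h : Y → X}

theorem Phi_symMono_eq_zero_iff {y : Y} {l : Fin n → ℕ} {u : E} :
    Phi T h (order l) y (symMono l u) = 0 ↔
      evalComp T y (monomialAt (h y : EuclideanSpace ℝ (Fin n)) l • Ck.const p X u) = 0 := by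
  rw [Phi, smul_eq_zero_iff_right (by positivity), powFun_symMono, evalComp_apply]

theorem continuous_map_mul_sub_algebraMap_pow_smul (T : Ck p X E →L[ℝ] Ck q Y F)
    {χ : Y → Smooth (EuclideanSpace ℝ (Fin n))}
    (hχ : ∀ f : Ck p X E, Continuous fun y => T (χ y • f) y) {c : Y → ℝ} (hc : Continuous c)
    (ξ : Smooth (EuclideanSpace ℝ (Fin n))) (m : ℕ) (f : Ck p X E) :
    Continuous fun y => T ((χ y * (ξ - algebraMap ℝ _ (c y)) ^ m) • f) y := by
  induction m generalizing f with
  | zero => simpa using hχ f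
  | succ m ih =>
    have hstep (y : Y) : (χ y * (ξ - algebraMap ℝ _ (c y)) ^ (m + 1)) • f =
        (χ y * (ξ - algebraMap ℝ _ (c y)) ^ m) • ξ • f -
          c y • (χ y * (ξ - algebraMap ℝ _ (c y)) ^ m) • f := by
      simp only [mul_smul (χ y), sub_algebraMap_pow_succ_smul, smul_sub, smul_comm (χ y) (c y)]
    refine ((ih (ξ • f)).sub (hc.smul (ih f))).congr fun y => ?_
    rw [hstep, map_sub, map_smul T (c y)]
    rfl

theorem continuous_map_monomialAt_smul (T : Ck p X E →L[ℝ] Ck q Y F) (hh : Continuous h)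
    (l : Fin n → ℕ) (f : Ck p X E) :
    Continuous fun y => T (monomialAt (h y : EuclideanSpace ℝ (Fin n)) l • f) y := by
  have hcoord (i : Fin n) : Continuous fun y => (h y : EuclideanSpace ℝ (Fin n)) i := by fun_prop
  suffices hS : ∀ (S : Finset (Fin n)) (f : Ck p X E), Continuous fun y =>
      T ((∏ i ∈ S, (coord i - algebraMap ℝ _ ((h y : EuclideanSpace ℝ (Fin n)) i)) ^ l i) • f) y
    from hS Finset.univ f
  intro S
  induction S using Finset.induction_on with
  | empty => exact fun f => by simpa using (T f).continuous
  | insert i S hi ih =>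
    simp only [Finset.prod_insert hi, mul_comm (_ ^ l i)]
    exact continuous_map_mul_sub_algebraMap_pow_smul T ih (hcoord i) (coord i) (l i)

theorem isOpen_goodSet (T : Ck p X E →L[ℝ] Ck q Y F) (hh : Continuous h) (i : Fin n) :
    IsOpen (goodSet T h i) := by
  refine isOpen_iff_mem_nhds.mpr ?_
  rintro y₀ ⟨_, V, hV, hyV, hzero, l, u, hl, rfl, hne⟩
  have hcont := continuous_map_monomialAt_smul T hh l (Ck.const p X u)
  filter_upwards [hV.mem_nhds hyV,
    hcont.continuousAt.eventually_ne (mt Phi_symMono_eq_zero_iff.mpr hne)] with y hy hyne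
  exact ⟨_, V, hV, hy, hzero, l, u, hl, rfl, mt Phi_symMono_eq_zero_iff.mp hyne⟩

theorem HasOrderLE.exists_Phi_symMono_ne_zero {y : Y} {N : ℕ}
    (hN : HasOrderLE (evalComp T y) (h y) N) (hy : ∃ f, T f y ≠ 0) :
    ∃ (l : Fin n → ℕ) (u : E),
      (order l : ℕ∞) ≤ p ∧ Phi T h (order l) y (symMono l u) ≠ 0 := by
  by_contra! hno
  obtain ⟨f, hf⟩ := hy
  have hzero := hN.map_monomialAt_smul_eq_zero (s := 0)
    (fun l _ hl u => Phi_symMono_eq_zero_iff.mp (hno l u hl)) f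
  rw [monomialAt_zero, one_smul] at hzero
  exact hf hzero

theorem HasOrderLE.Phi_symMono_eq_zero {y : Y} {N : ℕ}
    (hN : HasOrderLE (evalComp T y) (h y) N) {l : Fin n → ℕ} (hl : N < order l) (u : E) :
    Phi T h (order l) y (symMono l u) = 0 :=
  Phi_symMono_eq_zero_iff.mpr (hN.map_monomialAt_smul_eq_zero_of_lt hl _)

theorem dense_goodSet (hnt : IsNowhereTrivial T)
    (hfin : ∀ y₀ : Y, ∃ N, ∀ᶠ y in 𝓝 y₀, HasOrderLE (evalComp T y) (h y) N) (i : Fin n) :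
    Dense (goodSet T h i) := by
  classical
  refine dense_iff_inter_open.mpr fun W hW ⟨y₁, hy₁⟩ => ?_
  obtain ⟨N, hN⟩ := hfin y₁
  obtain ⟨V, hVN, hV, hyV⟩ := eventually_nhds_iff.mp (hN.and (hW.mem_nhds hy₁))
  let Z (m : ℕ) : Prop := ∃ V' ⊆ V, IsOpen V' ∧ V'.Nonempty ∧ ∀ y ∈ V', ∀ (u : E) (l : Fin n → ℕ),
    (order l : ℕ∞) ≤ p → m ≤ l i → Phi T h (order l) y (symMono l u) = 0
  have hex : ∃ m, Z m := ⟨N + 1, V, Subset.rfl, hV, ⟨y₁, hyV⟩, fun y hy u l _ hl =>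
    (hVN y hy).1.Phi_symMono_eq_zero
      (hl.trans (Finset.single_le_sum (fun _ _ => Nat.zero_le _) (Finset.mem_univ i))) u⟩
  obtain ⟨V', hV'V, hV', ⟨y₂, hy₂⟩, hzero⟩ := Nat.find_spec hex
  cases hm : Nat.find hex with
  | zero =>
    obtain ⟨l, u, hl, hne⟩ := (hVN y₂ (hV'V hy₂)).1.exists_Phi_symMono_ne_zero (hnt y₂)
    exact absurd (hzero y₂ hy₂ u l hl (hm ▸ Nat.zero_le _)) hne
  | succ m₀ =>
    rw [hm] at hzero
    have hmin : ¬Z m₀ := Nat.find_min hex (by omega)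
    simp only [Z, not_exists, not_and, not_forall] at hmin
    obtain ⟨y, hy, u, l, hl, hml, hne⟩ := hmin V' hV'V hV' ⟨y₂, hy₂⟩
    refine ⟨y, (hVN y (hV'V hy)).2, m₀, V', hV', hy, hzero, l, u, hl, ?_, hne⟩
    exact le_antisymm (Nat.le_of_not_lt fun hlt => hne (hzero y hy u l hl hlt)) hml

theorem HasOrderLE.map_sub_pow_smul_eq_zero {y : Y} {N m : ℕ} {i : Fin n}
    (hN : HasOrderLE (evalComp T y) (h y) N)
    (hzero : ∀ (u : E) (l : Fin n → ℕ), (order l : ℕ∞) ≤ p → m < l i →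
      Phi T h (order l) y (symMono l u) = 0) (f : Ck p X E) :
    evalComp T y ((coord i - algebraMap ℝ _ ((h y : EuclideanSpace ℝ (Fin n)) i)) ^ (m + 1) • f) =
      0 := by
  rw [← monomialAt_single]
  refine hN.map_monomialAt_smul_eq_zero (fun l hle hl u => ?_) f
  exact Phi_symMono_eq_zero_iff.mp (hzero u l hl (by simpa using hle i))

theorem exists_map_sub_pow_smul_ne_zero {y : Y} {l : Fin n → ℕ} {u : E}
    (hne : Phi T h (order l) y (symMono l u) ≠ 0) (i : Fin n) :
    ∃ f : Ck p X E, evalComp T y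
      ((coord i - algebraMap ℝ _ ((h y : EuclideanSpace ℝ (Fin n)) i)) ^ l i • f) ≠ 0 := by
  refine ⟨monomialAt (h y : EuclideanSpace ℝ (Fin n)) (Function.update l i 0) • Ck.const p X u, ?_⟩
  have hl : Pi.single i (l i) + Function.update l i 0 = l := by
    funext j
    rcases eq_or_ne j i with rfl | hj <;> simp [*]
  rw [smul_smul, ← monomialAt_single, ← monomialAt_add, hl]
  exact mt Phi_symMono_eq_zero_iff.mpr hne

theorem continuousAt_zeroExt {f : Y → E} (hf : Continuous f) (y : Y) :
    ContinuousAt (zeroExt (X := (Y : Set H)) f) y := by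
  rw [← Y.isOpen.isOpenEmbedding_subtypeVal.continuousAt_iff]
  exact (hf.congr fun z => (zeroExt_apply (X := (Y : Set H)) f z).symm).continuousAt

theorem contDiffAt_supportMap_coord (hh : Continuous h)
    (hfin : ∀ y₀ : Y, ∃ N, ∀ᶠ y in 𝓝 y₀, HasOrderLE (evalComp T y) (h y) N) {i : Fin n} {y₀ : Y}
    (hy₀ : y₀ ∈ goodSet T h i) :
    ContDiffAt ℝ q
      (zeroExt (X := (Y : Set H)) fun y => (h y : EuclideanSpace ℝ (Fin n)) i) y₀ := by
  obtain ⟨_, V, hV, hyV, hzero, l, u, -, rfl, hne⟩ := hy₀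
  obtain ⟨N, hN⟩ := hfin y₀
  obtain ⟨f, hf⟩ := exists_map_sub_pow_smul_ne_zero hne i
  obtain ⟨ψ, hψ⟩ := SeparatingDual.exists_ne_zero (R := ℝ) hf
  let g (j : Fin (l i + 1 + 1)) : Ck p X E :=
    ((-1) ^ (j : ℕ) * (l i + 1).choose j : ℝ) • coord i ^ (l i + 1 - j) • f
  have hexpand (y : Y) (s : ℝ) : ∑ j, ψ (zeroExt (X := (Y : Set H)) (T (g j)) y) * s ^ (j : ℕ) =
      ψ (evalComp T y ((coord i - algebraMap ℝ _ s) ^ (l i + 1) • f)) := by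
    simp only [sub_algebraMap_pow_smul_eq_sum, map_sum, map_smul, smul_eq_mul, mul_comm (s ^ _),
      evalComp_apply, zeroExt_apply (X := (Y : Set H)) _ y, g, Ck.smul_apply]
  refine contDiffAt_of_sum_mul_pow_eq_zero
    (c := fun j z => ψ (zeroExt (X := (Y : Set H)) (T (g j)) z))
    (fun j => ψ.contDiff.contDiffAt.comp _ ((T (g j)).contDiffAt y₀.2))
    (continuousAt_zeroExt (by fun_prop) y₀) ?_ (d := -(l i + 1) * ψ (evalComp T y₀
      ((coord i - algebraMap ℝ _ ((h y₀ : EuclideanSpace ℝ (Fin n)) i)) ^ l i • f))) ?_ ?_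
  · have hyV' : ∀ᶠ y in 𝓝 y₀, y ∈ V := hV.mem_nhds hyV
    rw [← map_nhds_subtype_coe_eq_nhds y₀.2 (Y.isOpen.mem_nhds y₀.2), eventually_map]
    filter_upwards [hyV', hN] with y hy hyN
    rw [zeroExt_apply _ y, hexpand, hyN.map_sub_pow_smul_eq_zero (hzero y hy), map_zero]
  · simp only [hexpand]
    rw [zeroExt_apply _ y₀]
    exact hasDerivAt_map_sub_algebraMap_pow_smul (ψ.toLinearMap ∘ₗ evalComp T y₀) _ f _ _
  · exact mul_ne_zero (neg_ne_zero.mpr (by positivity)) hψ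

theorem isCkOn_supportMap_coord (hh : Continuous h)
    (hfin : ∀ y₀ : Y, ∃ N, ∀ᶠ y in 𝓝 y₀, HasOrderLE (evalComp T y) (h y) N) (i : Fin n) :
    IsCkOn q (X := (Y : Set H)) (fun y => (h y : EuclideanSpace ℝ (Fin n)) i) (goodSet T h i) := by
  rintro _ ⟨y, hy, rfl⟩
  exact (contDiffAt_supportMap_coord hh hfin hy).contDiffWithinAt

theorem isCkOn_euclidean {f : Y → EuclideanSpace ℝ (Fin n)} {S : Set Y} :
    IsCkOn q (X := (Y : Set H)) f S ↔
      ∀ i, IsCkOn q (X := (Y : Set H)) (fun y => f y i) S := by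
  refine contDiffOn_euclidean.trans (forall_congr' fun i => contDiffOn_congr ?_)
  rintro _ ⟨y, -, rfl⟩
  rw [zeroExt_apply (X := (Y : Set H)) f y, zeroExt_apply (X := (Y : Set H)) (fun y => f y i) y]

end GoodSet

end SepMap

open SepMap in
theorem proposition29_general {n : ℕ}
    {H : Type*} [NormedAddCommGroup H] [NormedSpace ℝ H]
    {E : Type*} [NormedAddCommGroup E] [NormedSpace ℝ E]
    {F : Type*} [NormedAddCommGroup F] [NormedSpace ℝ F]
    (p q : ℕ∞) (X : Opens (EuclideanSpace ℝ (Fin n))) (Y : Opens H)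
    (T : Ck p X E →L[ℝ] Ck q Y F) (hsep : IsSeparating T) (hnt : IsNowhereTrivial T) :
    ∃ h : Y → X, IsSupportMap T h ∧
      (∀ i : Fin n, IsOpen (goodSet T h i) ∧ Dense (goodSet T h i) ∧
        IsCkOn q (X := (Y : Set H))
          (fun y => (h y : EuclideanSpace ℝ (Fin n)) i) (goodSet T h i)) ∧
      IsOpen (⋂ i : Fin n, goodSet T h i) ∧
      Dense (⋂ i : Fin n, goodSet T h i) ∧
      IsCkOn q (X := (Y : Set H))
        (fun y => (h y : EuclideanSpace ℝ (Fin n))) (⋂ i : Fin n, goodSet T h i) := by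
  choose h hh using fun y => exists_isSupportPt_evalComp T (hnt y)
  have hcont : Continuous h := continuous_of_isSupportPt hsep hh
  have hfin := eventually_hasOrderLE hsep hh
  have hopen (i : Fin n) : IsOpen (goodSet T h i) := isOpen_goodSet T hcont i
  have hdense (i : Fin n) : Dense (goodSet T h i) := dense_goodSet hnt hfin i
  have hCk (i : Fin n) := isCkOn_supportMap_coord hcont hfin i
  refine ⟨h, isSupportMap_of_isSupportPt hsep hh, fun i => ⟨hopen i, hdense i, hCk i⟩,
    isOpen_iInter_of_finite hopen, ?_, isCkOn_euclidean.mpr fun i => ?_⟩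
  · exact (finite_range _).dense_sInter (forall_mem_range.mpr hopen) (forall_mem_range.mpr hdense)
  · exact (hCk i).mono (image_mono (iInter_subset _ i))

theorem proposition29 {n : ℕ}
    {H : Type*} [NormedAddCommGroup H] [NormedSpace ℝ H] [CompleteSpace H]
    {E : Type*} [NormedAddCommGroup E] [NormedSpace ℝ E] [CompleteSpace E]
    {F : Type*} [NormedAddCommGroup F] [NormedSpace ℝ F] [CompleteSpace F]
    (p q : ℕ∞) (hp : 1 ≤ p)
    (X : TopologicalSpace.Opens (EuclideanSpace ℝ (Fin n))) (Y : TopologicalSpace.Opens H)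
    (T : SepMap.Ck p X E →L[ℝ] SepMap.Ck q Y F)
    (hsep : SepMap.IsSeparating T) (hnt : SepMap.IsNowhereTrivial T) :
    ∃ h : Y → X, SepMap.IsSupportMap T h ∧
      (∀ i : Fin n, IsOpen (SepMap.goodSet T h i) ∧ Dense (SepMap.goodSet T h i) ∧
        SepMap.IsCkOn q (X := (Y : Set H))
          (fun y => (h y : EuclideanSpace ℝ (Fin n)) i) (SepMap.goodSet T h i)) ∧
      IsOpen (⋂ i : Fin n, SepMap.goodSet T h i) ∧
      Dense (⋂ i : Fin n, SepMap.goodSet T h i) ∧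
      SepMap.IsCkOn q (X := (Y : Set H))
        (fun y => (h y : EuclideanSpace ℝ (Fin n))) (⋂ i : Fin n, SepMap.goodSet T h i) :=
  proposition29_general p q X Y T hsep hnt

end
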